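/- Let $d\in\{2,3\}$, let $\Omega\subset\mathbb{R}^d$ be a bounded domain (open, connected, nonempty), let $\epsilon>0$ and $H_\epsilon(x)=\{y:|y-x|<\epsilon\}$, and let $\omega_d$ be the volume of the unit ball of $\mathbb{R}^d$. Assume that $\Omega$ satisfies the interior cone condition: there are $\theta>0$ and $\lambda>0$ such that for every $x\in\Omega$ there is a unit vector $e_x$ for which the spherical cone with apex $x$, radius $\lambda$, axis $e_x$ and aperture angle $2\theta$ is contained in $\Omega$. Let $J:\mathbb{R}\to[0,\infty)$ be bounded and measurable, supported on $[0,1]$, with $J>0$ on $(0,1)$, and put $J^\epsilon(r)=J(r/\epsilon)$. Let $r^e<0<r^c$ and let $g:\mathbb{R}\to\mathbb{R}$ be three times differentiable with $g,g',g'',g'''$ bounded, $g(0)=0$, $g(r)>0$ for $r\neq0$, $g$ convex on $(r^e,r^c)$ with $g''>0$ there, $g$ concave on $(-\infty,r^e]$ and on $[r^c,\infty)$, with finite limits at $\pm\infty$, and $\max_r|g''(r)|=g''(0)$. For $y\ne x$ write $e_{y-x}=\frac{y-x}{|y-x|}$ and $S(y,x,u)=\frac{u(y)-u(x)}{|y-x|}\cdot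 e_{y-x}$. Let $\Pi=\{x\mapsto Qx+c : Q^T=-Q\in\mathbb{R}^{d\times d},\ c\in\mathbb{R}^d\}$ and $$\mathcal V=\Big\{u\in L^\infty(\Omega;\mathbb{R}^d):\ \int_\Omega u\cdot w\,dx=0\ \text{ for all } w\in\Pi\Big\}$$ with the $L^\infty$ norm, and let $\overline{\mathcal V}^2$ be the closure of $\mathcal V$ in $L^2(\Omega;\mathbb{R}^d)$. The force operator $\mathcal L$, its derivative and the stability tensor are $$\mathcal L[u](x)=-\int_{H_\epsilon(x)\cap\Omega}\frac{2J^\epsilon(|y-x|)}{\epsilon^{d+1}\omega_d\sqrt{|y-x|}}\,g'\big(\sqrt{|y-x|}\,S(y,x,u)\big)\,e_{y-x}\,dy,$$ $$D(\mathcal L)[u]w(x)=-\int_{H_\epsilon(x)\cap\Omega}\frac{2J^\epsilon(|y-x|)}{\epsilon^{d+1}\omega_d}\,g''\big(\sqrt{|y-x|}\,S(y,x,u)\big)\,S(y,x,w)\,e_{y-x}\,dy,$$ $$\mathbb A[u](x)=\int_{H_\epsilon(x)\cap\Omega}\frac{J^\epsilon(|y-x|)}{\epsilon^{d+1}\omega_d|y-x|}\,g''\big(\sqrt{|y-x|}\,S(y,x,u)\big)\,e_{y-x}\otimes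 e_{y-x}\,dy.$$ Let $u_0\in\mathcal V$ lie strictly inside the strength domain: there is a closed interval $[a,b]\subset(r^e,r^c)$ with $\sqrt{|y-x|}\,S(y,x,u_0)\in[a,b]$ for all $x\in\Omega$ and all $y\in\Omega\cap H_\epsilon(x)$, $y\neq x$. Then: 1. There is $\gamma>0$ such that $\mathbb A[u_0](x)v\cdot v>\gamma|v|^2$ for all $x\in\Omega$ and all $v\in\mathbb{R}^d\setminus\{0\}$. 2. $\operatorname{Ker}D(\mathcal L)[u_0]=\{0\}$: if $w\in\overline{\mathcal V}^2$ (in particular if $w\in\mathcal V$) and $D(\mathcal L)[u_0]w=0$ a.e. in $\Omega$, then $w=0$. 3. $\mathcal L$ maps $\mathcal V$ into $\mathcal V$, $D(\mathcal L)[u_0]:\mathcal V\to\mathcal V$ is the Fréchet derivative of $\mathcal L$ at $u_0$ with respect to the $L^\infty$ norm, and it is a bijection of $\mathcal V$ onto itself, bounded with bounded inverse $D(\mathcal L)[u_0]^{-1}$ in the $L^\infty$ norm. -/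

import Mathlib

open MeasureTheory
open scoped ENNReal

noncomputable section

namespace Peridynamics

/-- The ambient space `ℝ^d` with its Euclidean structure. -/
abbrev E (d : ℕ) : Type := EuclideanSpace ℝ (Fin d)

/-- Influence functions: bounded, measurable, nonnegative, supported on `[0,1]`, and positive
inside the horizon. -/
structure IsInfluenceFunction (J : ℝ → ℝ) : Prop where
  measurable : Measurable J
  bounded : ∃ C : ℝ, ∀ r, |J r| ≤ C
  nonneg : ∀ r, 0 ≤ J r
  support_subset : Function.support J ⊆ Set.Icc 0 1
  pos : ∀ r ∈ Set.Ioo (0 : ℝ) 1, 0 < J r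

/-- Cohesive potentials `g` with inflection points `re < 0 < rc`. -/
structure IsCohesivePotential (g : ℝ → ℝ) (re rc : ℝ) : Prop where
  re_neg : re < 0
  rc_pos : 0 < rc
  differentiable : ∀ k < 3, Differentiable ℝ (iteratedDeriv k g)
  bounded : ∀ k ≤ 3, ∃ C : ℝ, ∀ r, |iteratedDeriv k g r| ≤ C
  zero : g 0 = 0
  pos : ∀ r, r ≠ 0 → 0 < g r
  convexOn : ConvexOn ℝ (Set.Ioo re rc) g
  concaveOn_left : ConcaveOn ℝ (Set.Iic re) g
  concaveOn_right : ConcaveOn ℝ (Set.Ici rc) g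
  limit_left : ∃ C : ℝ, Filter.Tendsto g Filter.atBot (nhds C)
  limit_right : ∃ C : ℝ, Filter.Tendsto g Filter.atTop (nhds C)
  second_deriv_le : ∀ r, |iteratedDeriv 2 g r| ≤ iteratedDeriv 2 g 0
  second_deriv_pos : ∀ r ∈ Set.Ioo re rc, 0 < iteratedDeriv 2 g r

variable {d : ℕ}

/-- The closed spherical cone with apex `x`, radius `l`, aperture angle `2θ` and axis `e`. -/
def cone (l θ : ℝ) (x e : E d) : Set (E d) :=
  {y | y = x ∨ (‖y - x‖ ≤ l ∧ InnerProductGeometry.angle (y - x) e ≤ θ)}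

/-- The interior cone condition, with radius and angle uniform over `Ω`. -/
def InteriorConeCondition (Ω : Set (E d)) : Prop :=
  ∃ θ : ℝ, 0 < θ ∧ ∃ l : ℝ, 0 < l ∧ ∀ x ∈ Ω, ∃ e : E d, ‖e‖ = 1 ∧ cone l θ x e ⊆ Ω

/-- The unit vector `e_{y-x}`. -/
def bondDir (y x : E d) : E d := ‖y - x‖⁻¹ • (y - x)

/-- The nonlocal strain `S(y,x,u)`. -/
def strain (y x : E d) (u : E d → E d) : ℝ :=
  inner ℝ (‖y - x‖⁻¹ • (u y - u x)) (bondDir y x)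

/-- The neighbourhood `H_ε(x) ∩ Ω`. -/
def nbhd (Ω : Set (E d)) (ε : ℝ) (x : E d) : Set (E d) := Metric.ball x ε ∩ Ω

/-- The volume of the unit ball of `ℝ^d`. -/
def unitBallVolume (d : ℕ) : ℝ := (volume (Metric.ball (0 : E d) 1)).toReal

/-- `u` lies strictly inside the strength domain: the scaled strains of all bonds lie in one
closed interval contained in `(re, rc)`. -/
def StrictlyInsideStrengthDomain (Ω : Set (E d)) (ε re rc : ℝ) (u : E d → E d) : Prop :=
  ∃ a b : ℝ, re < a ∧ b < rc ∧ ∀ x ∈ Ω, ∀ y ∈ nbhd Ω ε x, y ≠ x →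
    Real.sqrt ‖y - x‖ * strain y x u ∈ Set.Icc a b

/-- The peridynamic force `𝓛[u](x)`. -/
def force (Ω : Set (E d)) (ε : ℝ) (J g : ℝ → ℝ) (u : E d → E d) (x : E d) : E d :=
  -∫ y in nbhd Ω ε x,
    (2 * (J (‖y - x‖ / ε) / (ε ^ (d + 1) * unitBallVolume d * Real.sqrt ‖y - x‖)) *
      deriv g (Real.sqrt ‖y - x‖ * strain y x u)) • bondDir y x

/-- The derivative `D(𝓛)[u] w` at `x`. -/
def forceDeriv (Ω : Set (E d)) (ε : ℝ) (J g : ℝ → ℝ) (u w : E d → E d) (x : E d) : E d :=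
  -∫ y in nbhd Ω ε x,
    (2 * (J (‖y - x‖ / ε) / (ε ^ (d + 1) * unitBallVolume d)) *
      iteratedDeriv 2 g (Real.sqrt ‖y - x‖ * strain y x u) * strain y x w) • bondDir y x

/-- The stability tensor `𝔸[u](x)`; `(innerSL ℝ e).smulRight e` is `e ⊗ e`. -/
def stabilityTensor (Ω : Set (E d)) (ε : ℝ) (J g : ℝ → ℝ) (u : E d → E d) (x : E d) :
    E d →L[ℝ] E d :=
  ∫ y in nbhd Ω ε x,
    (J (‖y - x‖ / ε) / (ε ^ (d + 1) * unitBallVolume d * ‖y - x‖) *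
      iteratedDeriv 2 g (Real.sqrt ‖y - x‖ * strain y x u)) •
        (innerSL ℝ (bondDir y x)).smulRight (bondDir y x)

/-- The rigid motions `x ↦ Q x + c` with `Q` skew-symmetric. -/
def rigidMotions (d : ℕ) : Set (E d → E d) :=
  {w | ∃ (Q : Matrix (Fin d) (Fin d) ℝ) (c : E d), Q.transpose = -Q ∧
    ∀ x, w x = WithLp.toLp 2 (Q.mulVec x.ofLp) + c}

/-- The space `𝒱` of essentially bounded displacements orthogonal to the rigid motions, with the
`L^∞(Ω; ℝ^d)` norm. For bounded `Ω` the integrability clause holds automatically. -/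
def V (Ω : Set (E d)) : Submodule ℝ (Lp (E d) ∞ (volume.restrict Ω)) where
  carrier := {u | ∀ w ∈ rigidMotions d,
    IntegrableOn (fun x => inner ℝ (u x) (w x)) Ω ∧ ∫ x in Ω, inner ℝ (u x) (w x) = 0}
  zero_mem' := by
    intro w _
    have h : (fun x => inner ℝ ((0 : Lp (E d) ∞ (volume.restrict Ω)) x) (w x))
        =ᵐ[volume.restrict Ω] fun _ => (0 : ℝ) := by
      filter_upwards [Lp.coeFn_zero (E d) ∞ (volume.restrict Ω)] with x hx
      rw [hx]
      simp
    exact ⟨(integrable_zero _ _ _).congr h.symm, by rw [integral_congr_ae h]; simp⟩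
  add_mem' := by
    intro u v hu hv w hw
    have h : (fun x => inner ℝ ((u + v) x) (w x))
        =ᵐ[volume.restrict Ω] fun x => (inner ℝ (u x) (w x) + inner ℝ (v x) (w x) : ℝ) := by
      filter_upwards [Lp.coeFn_add u v] with x hx
      rw [hx, Pi.add_apply, inner_add_left]
    refine ⟨((hu w hw).1.add (hv w hw).1).congr h.symm, ?_⟩
    rw [integral_congr_ae h, integral_add (hu w hw).1 (hv w hw).1, (hu w hw).2, (hv w hw).2,
      add_zero]
  smul_mem' := by
    intro c u hu w hw
    have h : (fun x => inner ℝ ((c • u) x) (w x))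
        =ᵐ[volume.restrict Ω] fun x => (c * inner ℝ (u x) (w x) : ℝ) := by
      filter_upwards [Lp.coeFn_smul c u] with x hx
      rw [hx, Pi.smul_apply, real_inner_smul_left]
    refine ⟨((hu w hw).1.const_mul c).congr h.symm, ?_⟩
    rw [integral_congr_ae h, integral_const_mul, (hu w hw).2, mul_zero]

/-- The closure of `𝒱` in `L²(Ω; ℝ^d)`. -/
def VL2 (Ω : Set (E d)) : Set (Lp (E d) 2 (volume.restrict Ω)) :=
  closure {v | ∃ u ∈ V Ω, v =ᵐ[volume.restrict Ω] u}

end Peridynamics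

end

/-! Write `kern` for the bond weight, which has size at most a constant times `‖z‖⁻¹`, and `Θ x y`
for `kern (y - x) * g''(stretch) • e ⊗ e`. Since `d ≥ 2`, `kern` is integrable, so the linearized
force splits as `D(𝓛)[u₀] w (x) = 2 (𝔸(x) w(x) - ∫ Θ x y (w y) dy)`: a multiplication operator minus
an integral operator `K`.

Coercivity: on bonds inside the strength domain `g''` is bounded below by some `m > 0`, and the
interior cone at `x` contains a ball of fixed size at fixed distance from `x`. The integral of `kern
z * ⟪e_z, v⟫²` over such a ball is bounded below uniformly in the direction of the axis and of `v`,
by compactness of the unit spheres (`exists_pos_lt_inner_stabilityTensor`).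

Kernel: pairing `D(𝓛)[u₀] w` with `w` and symmetrizing over bonds gives an integral of positive
weights times squared strains. If it vanishes, `w` has no strain on bonds shorter than `ε`, hence is
rigid on small balls and, by connectedness, on `Ω` (`exists_rigidMotion_ae_eq`). Orthogonality to
rigid motions then forces `w = 0` (`ae_eq_zero_of_forceDeriv_ae_eq_zero`).

Invertibility is a Fredholm alternative carried out directly in `L^∞`. The map `(x, p) ↦` (kernel at
`x` with displacement `p`) is continuous into `L¹`, and `(x, u₀ x)` stays in a compact set, so `K`
is a norm limit of finite rank operators (`exists_finiteRank_approx_bondKernel`). With coercivity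
and a Neumann series, `D(𝓛)[u₀] = B - F` with `B` bijective and `F` of finite rank
(`exists_linearizedForce`). The range lies in `𝒱` by the symmetry of bond forces; adding a finite
rank map `P` into the rigid motions gives an injective, hence surjective, operator, and restricting
to `𝒱` gives the isomorphism (`exists_equiv_V`).

Differentiability: the Taylor remainder of `g'` is quadratic in the stretch, which costs a factor
`‖z‖^(-1/2)`; the resulting weight `‖z‖^(-3/2)` is still integrable (`exists_norm_force_sub_le`). -/

noncomputable section

namespace Peridynamics

/-! ### Essential bounds, finite rank perturbations, symmetric operators. -/

section FunctionalAnalysis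

variable {α F : Type*} [MeasurableSpace α] {μ : Measure α} [NormedAddCommGroup F]

lemma ae_norm_le_norm_Linfty (u : Lp F ∞ μ) : ∀ᵐ x ∂μ, ‖u x‖ ≤ ‖u‖ := by
  have h := ae_le_eLpNormEssSup (f := (u : α → F)) (μ := μ)
  filter_upwards [h] with x hx
  rw [Lp.norm_def, eLpNorm_exponent_top]
  have hfin : eLpNormEssSup (u : α → F) μ ≠ ∞ := by
    have := Lp.eLpNorm_ne_top u
    rwa [eLpNorm_exponent_top] at this
  rw [← toReal_enorm]
  exact ENNReal.toReal_mono hfin hx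

lemma norm_Linfty_le_of_ae_le {u : Lp F ∞ μ} {C : ℝ} (hC : 0 ≤ C) (h : ∀ᵐ x ∂μ, ‖u x‖ ≤ C) :
    ‖u‖ ≤ C := by
  rw [Lp.norm_def, eLpNorm_exponent_top]
  refine ENNReal.toReal_le_of_le_ofReal hC ?_
  exact eLpNormEssSup_le_of_ae_bound h

lemma memLp_top_of_ae_le {f : α → F} {C : ℝ} (hf : AEStronglyMeasurable f μ)
    (h : ∀ᵐ x ∂μ, ‖f x‖ ≤ C) : MemLp f ∞ μ :=
  memLp_top_of_bound hf C h

/-- A map on `L^∞` given by an almost everywhere linear and bounded rule is a continuous linear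
map. -/
lemma exists_continuousLinearMap_Linfty [NormedSpace ℝ F] (S : Lp F ∞ μ → α → F) {M : ℝ}
    (hM : 0 ≤ M)
    (hmeas : ∀ u, AEStronglyMeasurable (S u) μ)
    (hbound : ∀ u, ∀ᵐ x ∂μ, ‖S u x‖ ≤ M * ‖u‖)
    (hadd : ∀ u v, S (u + v) =ᵐ[μ] S u + S v)
    (hsmul : ∀ (c : ℝ) u, S (c • u) =ᵐ[μ] c • S u) :
    ∃ T : Lp F ∞ μ →L[ℝ] Lp F ∞ μ, ‖T‖ ≤ M ∧ ∀ u, T u =ᵐ[μ] S u := by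
  have hmem u : MemLp (S u) ∞ μ := memLp_top_of_ae_le (hmeas u) (hbound u)
  have hco u : (hmem u).toLp =ᵐ[μ] S u := (hmem u).coeFn_toLp
  let T₀ : Lp F ∞ μ →ₗ[ℝ] Lp F ∞ μ :=
    { toFun := fun u => (hmem u).toLp
      map_add' := fun u v => by
        rw [← MemLp.toLp_add (hmem u) (hmem v)]
        exact (MemLp.toLp_eq_toLp_iff _ _).2 (hadd u v)
      map_smul' := fun c u => by
        rw [RingHom.id_apply, ← MemLp.toLp_const_smul c (hmem u)]
        exact (MemLp.toLp_eq_toLp_iff _ _).2 (hsmul c u) }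
  have hT u : ‖T₀ u‖ ≤ M * ‖u‖ := by
    refine norm_Linfty_le_of_ae_le (by positivity) ?_
    filter_upwards [hco u, hbound u] with x h1 h2
    exact (congrArg norm h1).trans_le h2
  exact ⟨T₀.mkContinuous M hT, T₀.mkContinuous_norm_le hM hT, hco⟩

/-- A finite rank perturbation of a bijective linear map is surjective as soon as it is
injective. -/
lemma surjective_of_injective_sub_finiteRank {X : Type*} [AddCommGroup X] [Module ℝ X]
    (B F : X →ₗ[ℝ] X) (hB : Function.Bijective B)
    (hF : FiniteDimensional ℝ (LinearMap.range F)) (hinj : Function.Injective (B - F)) :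
    Function.Surjective (B - F) := by
  let e := LinearEquiv.ofBijective B hB
  -- `B - F = B (1 - G)` with `G = B⁻¹ F` of finite rank. `1 - G` maps the finite-dimensional range
  -- of `G` to itself injectively, hence onto, and `(1 - G) x = B⁻¹ f` is solved by `x = B⁻¹ f + r`
  -- with `r - G r = G (B⁻¹ f)`.
  let G : X →ₗ[ℝ] X := e.symm.toLinearMap ∘ₗ F
  have hBG x : B (G x) = F x := e.apply_symm_apply (F x)
  have hG : FiniteDimensional ℝ (LinearMap.range G) := by
    rw [LinearMap.range_comp]
    infer_instance
  let R := LinearMap.range G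
  let N : R →ₗ[ℝ] R := LinearMap.id - (G.codRestrict R fun x => ⟨x, rfl⟩) ∘ₗ R.subtype
  have hN : Function.Injective N := by
    intro a b hab
    apply Subtype.ext
    apply hinj
    have h : (a : X) - G a = b - G b := congrArg Subtype.val hab
    have := congrArg B h
    simpa [map_sub, hBG] using this
  have hNs : Function.Surjective N := LinearMap.surjective_of_injective hN
  intro f
  obtain ⟨r, hr⟩ := hNs ⟨G (e.symm f), e.symm f, rfl⟩
  have hr' : (r : X) - G r = G (e.symm f) := congrArg Subtype.val hr
  refine ⟨e.symm f + r, ?_⟩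
  have h1 : B (e.symm f) = f := e.apply_symm_apply f
  have := congrArg B hr'
  rw [map_sub, hBG, hBG] at this
  simp only [LinearMap.sub_apply, map_add, h1, ← this]
  abel

/-- A symmetric operator whose quadratic form takes values in `[0, c‖v‖²]` has norm at most
`c`. -/
lemma norm_apply_le_of_quadraticForm_le {H : Type*} [NormedAddCommGroup H] [InnerProductSpace ℝ H]
    (N : H →L[ℝ] H) (hsymm : ∀ v w, inner ℝ (N v) w = inner ℝ v (N w)) {c : ℝ} (hc : 0 ≤ c)
    (h0 : ∀ v, 0 ≤ inner ℝ (N v) v) (h1 : ∀ v, inner ℝ (N v) v ≤ c * ‖v‖ ^ 2) (v : H) :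
    ‖N v‖ ≤ c * ‖v‖ := by
  have key : ‖N v‖ ^ 2 ≤ c * inner ℝ (N v) v := by
    -- For `c = 0` the form vanishes identically, and its value at `v + N v` is `2 ‖N v‖²`.
    by_cases hc0 : c = 0
    · have hz w : inner ℝ (N w) w = 0 := le_antisymm (by simpa [hc0] using h1 w) (h0 w)
      have := hz (v + N v)
      simp only [map_add, inner_add_left, inner_add_right, hz, hsymm (N v) v,
        real_inner_self_eq_norm_sq] at this
      have h2 := hz v
      nlinarith
    · have hcp : 0 < c := lt_of_le_of_ne hc (Ne.symm hc0)
      -- Nonnegativity here reads `c² ⟪N v, v⟫ - 2 c ‖N v‖² + ⟪N (N v), N v⟫ ≥ 0`; the last term is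
      -- at most `c ‖N v‖²`.
      have := h0 (c • v - N v)
      simp only [map_sub, map_smul, inner_sub_left, inner_sub_right, real_inner_smul_left,
        real_inner_smul_right, hsymm (N v) v, real_inner_self_eq_norm_sq] at this
      have h2 := h1 (N v)
      have h3 : c * ‖N v‖ ^ 2 ≤ c * (c * inner ℝ (N v) v) := by nlinarith
      exact le_of_mul_le_mul_left h3 hcp
  have h2 := h1 v
  refine le_of_sq_le_sq ?_ (by positivity)
  nlinarith [mul_le_mul_of_nonneg_left h2 hc]

end FunctionalAnalysis

/-! ### The bond weight, the stretch, and the operators as integrals over all of `Ω`. -/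

section Kernel

variable {d : ℕ} {ε : ℝ} {J : ℝ → ℝ}

/-- The unit vector in the direction of `z`. -/
def dir (z : E d) : E d := ‖z‖⁻¹ • z

/-- The rank one operator `e ⊗ e`. -/
def dyad (e : E d) : E d →L[ℝ] E d := (innerSL ℝ e).smulRight e

/-- The translation invariant part of the bond weight, including the factor `‖z‖⁻¹` of the
strain. -/
def kern (ε : ℝ) (J : ℝ → ℝ) (z : E d) : ℝ :=
  (Metric.ball (0 : E d) ε).indicator
    (fun z => J (‖z‖ / ε) / (ε ^ (d + 1) * unitBallVolume d * ‖z‖)) z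

/-- The scaled strain of a bond `z` with relative displacement `p`. -/
def stretch (z p : E d) : ℝ := (Real.sqrt ‖z‖)⁻¹ * inner ℝ p (dir z)

lemma unitBallVolume_pos : 0 < unitBallVolume d := by
  refine ENNReal.toReal_pos ?_ measure_ball_lt_top.ne
  exact (Metric.measure_ball_pos volume 0 one_pos).ne'

lemma dyad_apply (e v : E d) : dyad e v = (inner ℝ e v : ℝ) • e := rfl

lemma norm_dir_le (z : E d) : ‖dir z‖ ≤ 1 := by
  rw [dir, norm_smul, norm_inv, norm_norm]
  exact inv_mul_le_one

lemma dir_neg (z : E d) : dir (-z) = -dir z := by simp [dir]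

lemma norm_smul_dir (z : E d) : ‖z‖ • dir z = z := by
  by_cases hz : z = 0
  · simp [hz, dir]
  · rw [dir, smul_smul, mul_inv_cancel₀ (norm_ne_zero_iff.2 hz), one_smul]

lemma norm_dyad_dir_apply_le (z v : E d) : ‖dyad (dir z) v‖ ≤ ‖v‖ := by
  rw [dyad_apply, norm_smul]
  have h1 := norm_dir_le z
  have h2 : ‖(inner ℝ (dir z) v : ℝ)‖ ≤ 1 * ‖v‖ :=
    (norm_inner_le_norm _ _).trans (by gcongr)
  calc _ ≤ (1 * ‖v‖) * 1 := by gcongr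
    _ = ‖v‖ := by ring

lemma norm_dyad_dir_le (z : E d) : ‖dyad (dir z)‖ ≤ 1 :=
  ContinuousLinearMap.opNorm_le_bound _ zero_le_one fun v => by
    simpa using norm_dyad_dir_apply_le z v

lemma inner_dyad_symm (e v w : E d) : inner ℝ (dyad e v) w = inner ℝ v (dyad e w) := by
  simp only [dyad_apply, real_inner_smul_left, real_inner_smul_right, real_inner_comm v e]
  ring

lemma inner_dyad_self (e v : E d) : inner ℝ (dyad e v) v = (inner ℝ e v : ℝ) ^ 2 := by
  simp only [dyad_apply, real_inner_smul_left]
  ring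

lemma continuous_dyad : Continuous (dyad : E d → E d →L[ℝ] E d) := by
  have h : Continuous fun e : E d => ContinuousLinearMap.smulRightL ℝ (E d) (E d)
      (innerSL ℝ e) e := by fun_prop
  exact h

lemma measurable_dir : Measurable (dir : E d → E d) := by
  unfold dir
  fun_prop

lemma continuousAt_dir {z : E d} (hz : z ≠ 0) : ContinuousAt dir z := by
  unfold dir
  have : ‖z‖ ≠ 0 := norm_ne_zero_iff.2 hz
  fun_prop (disch := assumption)

lemma aemeasurable_stretch {α : Type*} [MeasurableSpace α] {ν : Measure α} {z p : α → E d}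
    (hz : AEMeasurable z ν) (hp : AEMeasurable p ν) :
    AEMeasurable (fun a => stretch (z a) (p a)) ν := by
  have h1 : AEMeasurable (fun a => dir (z a)) ν := measurable_dir.comp_aemeasurable hz
  unfold stretch
  exact (hz.norm.sqrt.inv).mul (hp.inner h1)

lemma continuousAt_stretch {z p : E d} (hz : z ≠ 0) :
    ContinuousAt (fun q : E d × E d => stretch q.1 q.2) (z, p) := by
  unfold stretch
  have h1 : √‖z‖ ≠ 0 := (Real.sqrt_pos.2 (norm_pos_iff.2 hz)).ne'
  have h2 : ContinuousAt (fun q : E d × E d => dir q.1) (z, p) :=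
    ContinuousAt.comp (f := Prod.fst) (x := (z, p)) (continuousAt_dir hz) continuousAt_fst
  have h3 : ContinuousAt (fun q : E d × E d => (√‖q.1‖)⁻¹) (z, p) :=
    ContinuousAt.inv₀ (by fun_prop) h1
  exact h3.mul (continuousAt_snd.inner h2)

lemma stretch_neg_neg (z p : E d) : stretch (-z) (-p) = stretch z p := by
  simp [stretch, dir_neg]

lemma stretch_add (z p q : E d) : stretch z (p + q) = stretch z p + stretch z q := by
  simp [stretch, inner_add_left, mul_add]

lemma abs_stretch_le (z p : E d) : |stretch z p| ≤ (Real.sqrt ‖z‖)⁻¹ * ‖p‖ := by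
  rw [stretch, abs_mul, abs_of_nonneg (by positivity)]
  gcongr
  calc _ ≤ ‖p‖ * ‖dir z‖ := abs_real_inner_le_norm _ _
    _ ≤ ‖p‖ * 1 := by gcongr; exact norm_dir_le z
    _ = _ := mul_one _

/-- Turns the scaled strain into a function of the two differences `y - x` and `u y - u x`, so that
translation invariance and joint continuity become available. For `y = x` both sides are `0` because
`0⁻¹ = 0`. -/
lemma sqrt_mul_strain (x y : E d) (u : E d → E d) :
    Real.sqrt ‖y - x‖ * strain y x u = stretch (y - x) (u y - u x) := by
  have h : bondDir y x = dir (y - x) := rfl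
  rw [strain, stretch, h, real_inner_smul_left, ← mul_assoc]
  congr 1
  by_cases hz : ‖y - x‖ = 0
  · simp [hz]
  · have h0 : 0 < ‖y - x‖ := lt_of_le_of_ne (norm_nonneg _) (Ne.symm hz)
    have h1 : √‖y - x‖ ≠ 0 := (Real.sqrt_pos.2 h0).ne'
    have h2 := Real.mul_self_sqrt h0.le
    field_simp
    nlinarith

lemma kern_nonneg (hε : 0 < ε) (hJ : IsInfluenceFunction J) (z : E d) : 0 ≤ kern ε J z := by
  refine Set.indicator_nonneg (fun z _ => ?_) z
  have := hJ.nonneg (‖z‖ / ε)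
  have := unitBallVolume_pos (d := d)
  positivity

lemma kern_pos (hε : 0 < ε) (hJ : IsInfluenceFunction J) {z : E d} (hz : z ≠ 0) (hzε : ‖z‖ < ε) :
    0 < kern ε J z := by
  have h0 := norm_pos_iff.2 hz
  have := hJ.pos (‖z‖ / ε) ⟨by positivity, (div_lt_one hε).2 hzε⟩
  have := unitBallVolume_pos (d := d)
  rw [kern, Set.indicator_of_mem (by simpa using hzε)]
  positivity

lemma kern_neg (z : E d) : kern ε J (-z) = kern ε J z := by
  simp [kern, Set.indicator]

lemma measurable_kern (hJ : IsInfluenceFunction J) : Measurable (kern ε J : E d → ℝ) := by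
  refine Measurable.indicator ?_ measurableSet_ball
  have := hJ.measurable
  fun_prop

lemma exists_kern_le (hε : 0 < ε) (hJ : IsInfluenceFunction J) :
    ∃ C, 0 ≤ C ∧ ∀ z : E d, kern ε J z ≤ C * ‖z‖⁻¹ := by
  obtain ⟨C, hC⟩ := hJ.bounded
  have hω := unitBallVolume_pos (d := d)
  have hC0 : 0 ≤ C := (abs_nonneg _).trans (hC 0)
  refine ⟨C / (ε ^ (d + 1) * unitBallVolume d), by positivity, fun z => ?_⟩
  refine Set.indicator_apply_le' (fun _ => ?_) (fun _ => by positivity)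
  rw [← div_div, div_eq_mul_inv _ ‖z‖]
  gcongr
  exact (le_abs_self _).trans (hC _)

/-- The dimension enters only here: `‖z‖ ^ (-α)` is integrable near `0` when `α < d`. It is used
with `α = 1` for the weight and `α = 3 / 2` for the Taylor remainder. -/
lemma integrable_of_norm_le_of_eq_zero {α C : ℝ} (hd : 2 ≤ d) (hα : α < 2) {f : E d → ℝ}
    (hf : Measurable f) (h0 : ∀ z, z ∉ Metric.ball (0 : E d) ε → f z = 0)
    (h : ∀ z, ‖f z‖ ≤ C * ‖z‖ ^ (-α)) : Integrable f := by
  have h2 : (2 : ℝ) ≤ d := by exact_mod_cast hd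
  have := integrableOn_ball_of_norm_le_rpow (E := E d) (μ := volume) (r := ε) (α := α) (f := f)
    (by simp; omega) (by simp; linarith) (Filter.Eventually.of_forall h) hf.aestronglyMeasurable
  rwa [integrableOn_iff_integrable_of_support_subset] at this
  intro z hz
  by_contra hcon
  exact hz (h0 z hcon)

lemma kern_eq_zero {z : E d} (hz : z ∉ Metric.ball (0 : E d) ε) : kern ε J z = 0 :=
  Set.indicator_of_notMem hz _

lemma integrable_kern (hd : 2 ≤ d) (hε : 0 < ε) (hJ : IsInfluenceFunction J) :
    Integrable (kern ε J : E d → ℝ) := by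
  obtain ⟨C, -, hC⟩ := exists_kern_le (d := d) hε hJ
  refine integrable_of_norm_le_of_eq_zero (α := 1) (C := C) hd (by norm_num) (measurable_kern hJ)
    (fun z hz => kern_eq_zero hz) fun z => ?_
  rw [Real.norm_of_nonneg (kern_nonneg hε hJ z), Real.rpow_neg_one]
  exact hC z

lemma integrable_kern_mul_inv_sqrt (hd : 2 ≤ d) (hε : 0 < ε) (hJ : IsInfluenceFunction J) :
    Integrable fun z : E d => kern ε J z * (Real.sqrt ‖z‖)⁻¹ := by
  obtain ⟨C, hC0, hC⟩ := exists_kern_le (d := d) hε hJ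
  refine integrable_of_norm_le_of_eq_zero (α := 3 / 2) (C := C) hd (by norm_num) ?_
    (fun z hz => by rw [kern_eq_zero hz, zero_mul]) fun z => ?_
  · have := measurable_kern (d := d) (ε := ε) hJ
    fun_prop
  rw [Real.norm_of_nonneg (mul_nonneg (kern_nonneg hε hJ z) (by positivity))]
  by_cases hz : z = 0
  · simp only [hz, norm_zero, Real.sqrt_zero, inv_zero, mul_zero]
    positivity
  have h0 := norm_pos_iff.2 hz
  have h1 : ‖z‖ ^ (-(3 / 2) : ℝ) = ‖z‖⁻¹ * (Real.sqrt ‖z‖)⁻¹ := by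
    rw [Real.sqrt_eq_rpow, ← Real.rpow_neg h0.le, ← Real.rpow_neg_one, ← Real.rpow_add h0]
    norm_num
  rw [h1, ← mul_assoc]
  gcongr
  exact hC z

lemma integral_nbhd_eq {G : Type*} [NormedAddCommGroup G] [NormedSpace ℝ G] (Ω : Set (E d))
    (x : E d) {f f' : E d → G} (h1 : ∀ y ∈ Metric.ball x ε, f y = f' y)
    (h2 : ∀ y ∉ Metric.ball x ε, f' y = 0) :
    ∫ y in nbhd Ω ε x, f y = ∫ y in Ω, f' y := by
  rw [nbhd, Set.inter_comm, ← setIntegral_indicator measurableSet_ball]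
  congr 1
  ext y
  by_cases hy : y ∈ Metric.ball x ε
  · rw [Set.indicator_of_mem hy, h1 y hy]
  · rw [Set.indicator_of_notMem hy, h2 y hy]

lemma kern_sub_eq {x y : E d} (hy : y ∈ Metric.ball x ε) :
    kern ε J (y - x) = J (‖y - x‖ / ε) / (ε ^ (d + 1) * unitBallVolume d * ‖y - x‖) :=
  Set.indicator_of_mem (by simpa [dist_eq_norm] using hy) _

lemma kern_sub_eq_zero {x y : E d} (hy : y ∉ Metric.ball x ε) : kern ε J (y - x) = 0 :=
  kern_eq_zero (by simpa [dist_eq_norm] using hy)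

lemma stabilityTensor_eq (Ω : Set (E d)) (g : ℝ → ℝ) (u : E d → E d) (x : E d) :
    stabilityTensor Ω ε J g u x = ∫ y in Ω,
      (kern ε J (y - x) * iteratedDeriv 2 g (stretch (y - x) (u y - u x))) •
        dyad (dir (y - x)) := by
  refine integral_nbhd_eq Ω x (fun y hy => ?_) (fun y hy => ?_)
  · rw [kern_sub_eq hy, sqrt_mul_strain]
    rfl
  · rw [kern_sub_eq_zero hy, zero_mul]
    exact zero_smul ℝ (dyad (dir (y - x)))

lemma forceDeriv_eq (Ω : Set (E d)) (g : ℝ → ℝ) (u w : E d → E d) (x : E d) :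
    forceDeriv Ω ε J g u w x = -∫ y in Ω,
      (2 * (kern ε J (y - x) * iteratedDeriv 2 g (stretch (y - x) (u y - u x)))) •
        dyad (dir (y - x)) (w y - w x) := by
  refine congrArg Neg.neg (integral_nbhd_eq Ω x (fun y hy => ?_) (fun y hy => ?_))
  · have h : bondDir y x = dir (y - x) := rfl
    rw [kern_sub_eq hy, sqrt_mul_strain, strain, h, dyad_apply, smul_smul, real_inner_smul_left,
      real_inner_comm]
    congr 1
    simp only [div_eq_mul_inv, mul_inv]
    ring
  · rw [kern_sub_eq_zero hy, zero_mul, mul_zero, zero_smul]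

/-- `kern` carries `‖z‖⁻¹` while the force only carries `(√‖z‖)⁻¹`, whence the compensating factor
`√‖z‖`. -/
lemma force_eq (Ω : Set (E d)) (g : ℝ → ℝ) (u : E d → E d) (x : E d) :
    force Ω ε J g u x = -∫ y in Ω,
      (2 * (kern ε J (y - x) * Real.sqrt ‖y - x‖ * deriv g (stretch (y - x) (u y - u x)))) •
        dir (y - x) := by
  refine congrArg Neg.neg (integral_nbhd_eq Ω x (fun y hy => ?_) (fun y hy => ?_))
  · have h : bondDir y x = dir (y - x) := rfl
    rw [kern_sub_eq hy, sqrt_mul_strain, h, ← mul_assoc]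
    congr 2
    by_cases hz : ‖y - x‖ = 0
    · simp [hz]
    · have h0 : 0 < ‖y - x‖ := lt_of_le_of_ne (norm_nonneg _) (Ne.symm hz)
      have h1 : √‖y - x‖ ≠ 0 := (Real.sqrt_pos.2 h0).ne'
      have h2 := Real.mul_self_sqrt h0.le
      have : (√‖y - x‖)⁻¹ = ‖y - x‖⁻¹ * √‖y - x‖ := by
        field_simp
        nlinarith
      simp only [div_eq_mul_inv, mul_inv, this]
      ring
  · rw [kern_sub_eq_zero hy, zero_mul, zero_mul, mul_zero, zero_smul]

/-- Continuity of translations in `L¹`. -/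
lemma tendsto_integral_norm_translate_sub {f : E d → ℝ} (hf : Integrable f) (x₀ : E d) :
    Filter.Tendsto (fun x => ∫ y, ‖f (y - x) - f (y - x₀)‖) (nhds x₀) (nhds 0) := by
  let F : Lp ℝ 1 (volume : Measure (E d)) := (memLp_one_iff_integrable.2 hf).toLp f
  -- The translations form a continuous family in the compact-open topology, and composing a fixed
  -- `L¹` class with such a measure preserving family is continuous in `L¹`.
  let τ : E d → C(E d, E d) := fun x => ⟨fun y => y - x, by fun_prop⟩
  have hτ : Continuous τ := by
    refine ContinuousMap.continuous_of_continuous_uncurry _ ?_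
    exact continuous_snd.sub continuous_fst
  have hmp x : MeasurePreserving (τ x) volume volume := measurePreserving_sub_right volume x
  have h := (continuous_const (y := F)).compMeasurePreservingLp hτ hmp ENNReal.one_ne_top
  have h2 := (h.sub (continuous_const (y := Lp.compMeasurePreserving (τ x₀) (hmp x₀) F))).norm.tendsto
    x₀
  simp only [Pi.sub_apply, sub_self, norm_zero] at h2
  refine h2.congr fun x => ?_
  rw [L1.norm_eq_integral_norm]
  refine integral_congr_ae ?_
  have hF : F =ᵐ[volume] f := (memLp_one_iff_integrable.2 hf).coeFn_toLp
  filter_upwards [Lp.coeFn_sub (Lp.compMeasurePreserving (τ x) (hmp x) F)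
    (Lp.compMeasurePreserving (τ x₀) (hmp x₀) F), Lp.coeFn_compMeasurePreserving F (hmp x),
    Lp.coeFn_compMeasurePreserving F (hmp x₀), (hmp x).quasiMeasurePreserving.ae hF,
    (hmp x₀).quasiMeasurePreserving.ae hF] with y h1 h2 h3 h4 h5
  rw [h1, Pi.sub_apply, h2, h3, Function.comp_apply, Function.comp_apply, h4, h5]
  rfl

end Kernel

/-! ### Uniform positivity of the stability tensor. -/

section Stability

variable {d : ℕ} {ε : ℝ} {J : ℝ → ℝ}

lemma aemeasurable_kern_mul_stretch {α : Type*} [MeasurableSpace α] {ν : Measure α}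
    (hJ : IsInfluenceFunction J) {h : ℝ → ℝ} (hh : Measurable h) {z p : α → E d}
    (hz : AEMeasurable z ν) (hp : AEMeasurable p ν) :
    AEMeasurable (fun a => kern ε J (z a) * h (stretch (z a) (p a))) ν := by
  have h1 : AEMeasurable (fun a => kern ε J (z a)) ν := (measurable_kern hJ).comp_aemeasurable hz
  exact h1.mul (hh.comp_aemeasurable (aemeasurable_stretch hz hp))

lemma aestronglyMeasurable_kern_mul_stretch {μ : Measure (E d)} (hJ : IsInfluenceFunction J)
    {h : ℝ → ℝ} (hh : Measurable h) {u : E d → E d} (hu : AEStronglyMeasurable u μ) (x p : E d) :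
    AEStronglyMeasurable (fun y => kern ε J (y - x) * h (stretch (y - x) (u y - p))) μ :=
  (aemeasurable_kern_mul_stretch hJ hh (measurable_id.sub_const x).aemeasurable
    (hu.aemeasurable.sub_const p)).aestronglyMeasurable

lemma integrable_kern_sub (hd : 2 ≤ d) (hε : 0 < ε) (hJ : IsInfluenceFunction J) (x : E d)
    (Ω : Set (E d)) : Integrable (fun y => kern ε J (y - x)) (volume.restrict Ω) :=
  ((integrable_kern hd hε hJ).comp_sub_right x).restrict

lemma integrable_kern_mul_stretch (hd : 2 ≤ d) (hε : 0 < ε) (hJ : IsInfluenceFunction J)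
    {Ω : Set (E d)} {h : ℝ → ℝ} (hh : Measurable h) {C : ℝ} (hC : ∀ r, |h r| ≤ C)
    {u : E d → E d} (hu : AEStronglyMeasurable u (volume.restrict Ω)) (x p : E d) :
    Integrable (fun y => kern ε J (y - x) * h (stretch (y - x) (u y - p)))
      (volume.restrict Ω) := by
  refine ((integrable_kern_sub hd hε hJ x Ω).const_mul C).mono'
    (aestronglyMeasurable_kern_mul_stretch hJ hh hu x p) (Filter.Eventually.of_forall fun y => ?_)
  rw [norm_mul, Real.norm_of_nonneg (kern_nonneg hε hJ _), mul_comm]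
  have := kern_nonneg hε hJ (y - x)
  gcongr
  exact hC _

lemma aestronglyMeasurable_dyad_dir_sub {μ : Measure (E d)} (x : E d) :
    AEStronglyMeasurable (fun y => dyad (dir (y - x))) μ :=
  continuous_dyad.comp_aestronglyMeasurable
    (measurable_dir.comp (measurable_id.sub_const x)).aestronglyMeasurable

lemma integrable_smul_dyad {μ : Measure (E d)} {f : E d → ℝ} (hf : Integrable f μ) (x : E d) :
    Integrable (fun y => f y • dyad (dir (y - x))) μ := by
  refine hf.norm.mono' (hf.1.smul (aestronglyMeasurable_dyad_dir_sub x))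
    (Filter.Eventually.of_forall fun y => ?_)
  rw [norm_smul]
  exact mul_le_of_le_one_right (norm_nonneg _) (norm_dyad_dir_le _)

lemma integral_smul_dyad_apply {μ : Measure (E d)} {f : E d → ℝ} (hf : Integrable f μ)
    (x v : E d) :
    (∫ y, f y • dyad (dir (y - x)) ∂μ) v = ∫ y, f y • dyad (dir (y - x)) v ∂μ :=
  ContinuousLinearMap.integral_apply (integrable_smul_dyad hf x) v

lemma inner_integral_smul_dyad {μ : Measure (E d)} {f : E d → ℝ} (hf : Integrable f μ)
    (x v w : E d) :
    inner ℝ ((∫ y, f y • dyad (dir (y - x)) ∂μ) v) w =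
      ∫ y, f y * inner ℝ (dyad (dir (y - x)) v) w ∂μ := by
  rw [integral_smul_dyad_apply hf, real_inner_comm, ← integral_inner]
  · simp only [real_inner_smul_right, real_inner_comm]
  · exact (integrable_smul_dyad hf x).apply_continuousLinearMap v

/-- Replaces the cone by a ball, whose size is proportional to its distance `s` from the apex and
independent of apex and axis. -/
lemma exists_ball_subset_cone {θ : ℝ} (hθ : 0 < θ) :
    ∃ τ : ℝ, 0 < τ ∧ τ ≤ 1 ∧ ∀ s l : ℝ, 0 < s → 2 * s ≤ l → ∀ x e : E d, ‖e‖ = 1 →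
      Metric.ball (x + s • e) (τ * s) ⊆ cone l θ x e := by
  set c := Real.cos (min θ Real.pi) with hc
  have hm0 : 0 < min θ Real.pi := lt_min hθ Real.pi_pos
  have hc1 : c < 1 := by
    rw [hc, ← Real.cos_zero]
    exact Real.cos_lt_cos_of_nonneg_of_le_pi le_rfl (min_le_right _ _) hm0
  have hc2 : -1 ≤ c := Real.neg_one_le_cos _
  -- For `z = y - x` in the shifted ball, `‖z‖ ≤ (1 + τ) s` and `⟪z, e⟫ > (1 - τ) s`. Since `1 + c ≤
  -- 2`, `τ = (1 - c) / 2` gives `c (1 + τ) ≤ 1 - τ`, which puts the cosine of the angle above `c`.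
  refine ⟨(1 - c) / 2, by linarith, by linarith, fun s l hs hsl x e he y hy => ?_⟩
  set τ := (1 - c) / 2 with hτ
  set z := y - x with hz
  have hh : ‖z - s • e‖ < τ * s := by
    rw [mem_ball_iff_norm] at hy
    rwa [hz, sub_sub]
  have hse : ‖s • e‖ = s := by rw [norm_smul, he, mul_one, Real.norm_of_nonneg hs.le]
  have hzle : ‖z‖ ≤ s + τ * s := by
    have := norm_add_le (s • e) (z - s • e)
    rw [add_sub_cancel] at this
    linarith
  have hzin : s - τ * s < inner ℝ z e := by
    have h1 : inner ℝ z e = s + inner ℝ (z - s • e) e := by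
      rw [inner_sub_left z, real_inner_smul_left, real_inner_self_eq_norm_sq, he]
      ring
    have h2 := abs_real_inner_le_norm (z - s • e) e
    rw [he, mul_one] at h2
    have := neg_abs_le (inner ℝ (z - s • e) e)
    linarith
  have hτ1 : τ ≤ 1 := by rw [hτ]; linarith
  have hzpos : 0 < ‖z‖ := by
    have h1 := real_inner_le_norm z e
    rw [he, mul_one] at h1
    nlinarith
  right
  refine ⟨by nlinarith, ?_⟩
  have key : c ≤ inner ℝ z e / (‖z‖ * ‖e‖) := by
    rw [he, mul_one, le_div_iff₀ hzpos]
    by_cases hcn : c ≤ 0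
    · nlinarith
    · have h1 : c * ‖z‖ ≤ c * (s + τ * s) := by gcongr; linarith
      have h2 : c * (s + τ * s) ≤ s - τ * s := by
        have : c * (1 + τ) ≤ 1 - τ := by rw [hτ]; nlinarith
        nlinarith
      linarith
  calc InnerProductGeometry.angle z e ≤ Real.arccos c := Real.antitone_arccos key
    _ = min θ Real.pi := Real.arccos_cos hm0.le (min_le_right _ _)
    _ ≤ θ := min_le_left _ _

lemma integrable_kern_mul_sq (hd : 2 ≤ d) (hε : 0 < ε) (hJ : IsInfluenceFunction J) (v : E d) :
    Integrable fun z : E d => kern ε J z * (inner ℝ (dir z) v : ℝ) ^ 2 := by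
  have hm := measurable_kern (d := d) (ε := ε) hJ
  have hdir := measurable_dir (d := d)
  refine ((integrable_kern (d := d) hd hε hJ).mul_const (‖v‖ ^ 2)).mono'
    (by fun_prop) (Filter.Eventually.of_forall fun z => ?_)
  have hk := kern_nonneg hε hJ z
  rw [norm_mul, Real.norm_of_nonneg hk, norm_pow]
  gcongr
  calc _ ≤ ‖dir z‖ * ‖v‖ := norm_inner_le_norm _ _
    _ ≤ 1 * ‖v‖ := by gcongr; exact norm_dir_le z
    _ = _ := one_mul _

/-- The integrand vanishes on the ball only on the hyperplane orthogonal to `v`, which is null and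
contains the origin, the one other point where the weight may vanish. -/
lemma setIntegral_kern_mul_sq_pos (hd : 2 ≤ d) (hε : 0 < ε) (hJ : IsInfluenceFunction J)
    {c : E d} {r : ℝ} (hr : 0 < r) (hcr : Metric.ball c r ⊆ Metric.ball 0 ε) {v : E d}
    (hv : v ≠ 0) :
    0 < ∫ z in Metric.ball c r, kern ε J z * (inner ℝ (dir z) v : ℝ) ^ 2 := by
  rw [setIntegral_pos_iff_support_of_nonneg_ae]
  · let W : Submodule ℝ (E d) := LinearMap.ker (innerSL ℝ v).toLinearMap
    have hW : volume (W : Set (E d)) = 0 := by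
      refine Measure.addHaar_submodule volume W fun htop => hv ?_
      have : v ∈ W := by rw [htop]; trivial
      exact inner_self_eq_zero.1 this
    have hsub : Metric.ball c r \ W ⊆
        Function.support (fun z : E d => kern ε J z * (inner ℝ (dir z) v : ℝ) ^ 2) ∩
          Metric.ball c r := by
      rintro z ⟨hz, hzW⟩
      refine ⟨?_, hz⟩
      have hin : inner ℝ z v ≠ 0 := fun h => hzW (by
        change inner ℝ v z = 0
        rwa [real_inner_comm])
      have hz0 : z ≠ 0 := by rintro rfl; simp at hin
      have h1 := kern_pos hε hJ hz0 (by simpa using hcr hz)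
      have h2 : inner ℝ (dir z) v ≠ 0 := by
        rw [dir, real_inner_smul_left]
        exact mul_ne_zero (inv_ne_zero (norm_ne_zero_iff.2 hz0)) hin
      exact mul_ne_zero h1.ne' (pow_ne_zero 2 h2)
    refine lt_of_lt_of_le ?_ (measure_mono hsub)
    rw [measure_sdiff_null hW]
    exact Metric.measure_ball_pos volume c hr
  · exact Filter.Eventually.of_forall fun z => mul_nonneg (kern_nonneg hε hJ z) (sq_nonneg _)
  · exact (integrable_kern_mul_sq hd hε hJ v).integrableOn

lemma exists_le_setIntegral_kern_mul_sq (hd : 2 ≤ d) (hε : 0 < ε) (hJ : IsInfluenceFunction J)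
    {s r : ℝ} (hs : 0 < s) (hr : 0 < r) (hsr : s + r ≤ ε) :
    ∃ δ : ℝ, 0 < δ ∧ ∀ e v : E d, ‖e‖ = 1 → δ * ‖v‖ ^ 2 ≤
      ∫ z in Metric.ball (s • e) r, kern ε J z * (inner ℝ (dir z) v : ℝ) ^ 2 := by
  set Q : E d → E d → ℝ → ℝ := fun e v r =>
    ∫ z in Metric.ball (s • e) r, kern ε J z * (inner ℝ (dir z) v : ℝ) ^ 2 with hQ
  have hcompact : IsCompact (Metric.sphere (0 : E d) 1 ×ˢ Metric.sphere (0 : E d) 1) :=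
    (isCompact_sphere _ _).prod (isCompact_sphere _ _)
  have hmain : ∃ δ : ℝ, 0 < δ ∧
      ∀ q ∈ Metric.sphere (0 : E d) 1 ×ˢ Metric.sphere (0 : E d) 1, δ ≤ Q q.1 q.2 r := by
    refine hcompact.induction_on (p := fun S => ∃ δ : ℝ, 0 < δ ∧ ∀ q ∈ S, δ ≤ Q q.1 q.2 r)
      ⟨1, one_pos, by simp⟩ ?_ ?_ ?_
    · rintro S S' hS ⟨δ, h0, h⟩
      exact ⟨δ, h0, fun q hq => h q (hS hq)⟩
    · rintro S S' ⟨δ, h0, h⟩ ⟨δ', h0', h'⟩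
      refine ⟨min δ δ', lt_min h0 h0', ?_⟩
      rintro q (hq | hq)
      · exact (min_le_left _ _).trans (h q hq)
      · exact (min_le_right _ _).trans (h' q hq)
    · rintro ⟨e₀, v₀⟩ ⟨he₀, hv₀⟩
      simp only [mem_sphere_iff_norm, sub_zero] at he₀ hv₀
      have hsub0 : Metric.ball (s • e₀) (r / 2) ⊆ Metric.ball 0 ε := by
        intro z hz
        rw [mem_ball_iff_norm] at hz
        rw [mem_ball_zero_iff]
        have := norm_add_le (s • e₀) (z - s • e₀)
        rw [add_sub_cancel, norm_smul, he₀, Real.norm_of_nonneg hs.le] at this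
        linarith
      have hpos : 0 < Q e₀ v₀ (r / 2) :=
        setIntegral_kern_mul_sq_pos hd hε hJ (half_pos hr) hsub0
          (norm_ne_zero_iff.1 (by rw [hv₀]; norm_num))
      have hint : Integrable (kern ε J) (volume.restrict (Metric.ball (s • e₀) (r / 2))) :=
        (integrable_kern hd hε hJ).restrict
      have hcont : Continuous fun v => Q e₀ v (r / 2) := by
        have h1 : (fun v => Q e₀ v (r / 2)) = fun v => inner ℝ
            ((∫ z in Metric.ball (s • e₀) (r / 2), kern ε J z • dyad (dir (z - 0))) v) v := by
          ext v
          rw [inner_integral_smul_dyad hint]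
          simp only [sub_zero, inner_dyad_self, hQ]
        rw [h1]
        fun_prop
      -- Halving the radius keeps the ball at `s • e₀` inside the ball of radius `r` at `s • e` for
      -- nearby `e`, so only continuity in `v` is needed.
      refine ⟨{e | ‖e - e₀‖ * s < r / 2} ×ˢ {v | Q e₀ v₀ (r / 2) / 2 < Q e₀ v (r / 2)}, ?_,
        Q e₀ v₀ (r / 2) / 2, half_pos hpos, ?_⟩
      · refine mem_nhdsWithin_of_mem_nhds (prod_mem_nhds ?_ ?_)
        · refine (isOpen_lt (by fun_prop) continuous_const).mem_nhds ?_
          simpa using hr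
        · exact (isOpen_lt continuous_const hcont).mem_nhds (half_lt_self hpos)
      · rintro ⟨e, v⟩ ⟨he, hv⟩
        refine le_of_lt (lt_of_lt_of_le hv ?_)
        refine setIntegral_mono_set (integrable_kern_mul_sq hd hε hJ v).integrableOn
          (Filter.Eventually.of_forall fun z => mul_nonneg (kern_nonneg hε hJ z) (sq_nonneg _))
          (LE.le.eventuallyLE ?_)
        refine Metric.ball_subset_ball' ?_
        have : dist (s • e₀) (s • e) = ‖e - e₀‖ * s := by
          rw [dist_comm, dist_eq_norm, ← smul_sub, norm_smul, Real.norm_of_nonneg hs.le, mul_comm]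
        rw [this]
        have : ‖e - e₀‖ * s < r / 2 := he
        linarith
  obtain ⟨δ, h0, h⟩ := hmain
  refine ⟨δ, h0, fun e v he => ?_⟩
  by_cases hv : v = 0
  · simp [hv]
  have hv0 := norm_ne_zero_iff.2 hv
  have h1 := h (e, ‖v‖⁻¹ • v) ⟨by simpa using he, by simp [norm_smul, hv0]⟩
  have h2 : Q e (‖v‖⁻¹ • v) r = (‖v‖ ^ 2)⁻¹ * Q e v r := by
    simp only [hQ]
    rw [← integral_const_mul]
    congr 1
    ext z
    rw [real_inner_smul_right]
    ring
  rw [h2, inv_mul_eq_div, le_div_iff₀ (by positivity)] at h1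
  exact h1

lemma exists_pos_le_iteratedDeriv {g : ℝ → ℝ} {re rc a b : ℝ} (hg : IsCohesivePotential g re rc)
    (ha : re < a) (hb : b < rc) : ∃ m : ℝ, 0 < m ∧ ∀ r ∈ Set.Icc a b, m ≤ iteratedDeriv 2 g r := by
  by_cases hab : a ≤ b
  · obtain ⟨r, hr, hmin⟩ := isCompact_Icc.exists_isMinOn (Set.nonempty_Icc.2 hab)
      (hg.differentiable 2 (by norm_num)).continuous.continuousOn
    exact ⟨_, hg.second_deriv_pos r ⟨ha.trans_le hr.1, hr.2.trans_lt hb⟩, fun t ht => hmin ht⟩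
  -- An empty interval is allowed by the strength condition; any constant then serves.
  · exact ⟨1, one_pos, fun r hr => absurd (hr.1.trans hr.2) hab⟩

/-- The quadratic form is the integral of `kern * g'' * ⟪e, v⟫²`, whose integrand is nonnegative on
`Ω`; it may be restricted to a ball inside the cone at `x`, where `g'' ≥ m`. -/
theorem exists_pos_lt_inner_stabilityTensor (hd : 2 ≤ d) {Ω : Set (E d)} (hΩ : IsOpen Ω)
    (hcone : InteriorConeCondition Ω) (hε : 0 < ε) (hJ : IsInfluenceFunction J)
    {g : ℝ → ℝ} {re rc : ℝ} (hg : IsCohesivePotential g re rc) {u : E d → E d}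
    (hu : AEStronglyMeasurable u (volume.restrict Ω))
    (huS : StrictlyInsideStrengthDomain Ω ε re rc u) :
    ∃ γ : ℝ, 0 < γ ∧ ∀ x ∈ Ω, ∀ v : E d, v ≠ 0 →
      γ * ‖v‖ ^ 2 < inner ℝ (stabilityTensor Ω ε J g u x v) v := by
  obtain ⟨a, b, ha, hb, hS⟩ := huS
  obtain ⟨m, hm, hmle⟩ := exists_pos_le_iteratedDeriv hg ha hb
  obtain ⟨θ, hθ, l, hl, hc⟩ := hcone
  obtain ⟨τ, hτ, hτ1, hball⟩ := exists_ball_subset_cone (d := d) hθ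
  -- With `τ ≤ 1`, this keeps the ball both within the cone radius (`2 s ≤ l`) and within the
  -- horizon (`s + τ s ≤ ε`).
  set s := min l ε / 2 with hs
  have hs0 : 0 < s := half_pos (lt_min hl hε)
  have hsl : 2 * s ≤ l := by linarith [min_le_left l ε]
  have hsε : 2 * s ≤ ε := by linarith [min_le_right l ε]
  have hsr : s + τ * s ≤ ε := by nlinarith
  obtain ⟨δ, hδ, hδle⟩ := exists_le_setIntegral_kern_mul_sq (d := d) hd hε hJ hs0
    (mul_pos hτ hs0) hsr
  obtain ⟨C, hC⟩ := hg.bounded 2 (by norm_num)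
  have hh : Measurable (iteratedDeriv 2 g) :=
    (hg.differentiable 2 (by norm_num)).continuous.measurable
  -- The bound obtained is `m * δ`; half of it makes the inequality strict.
  refine ⟨m * δ / 2, by positivity, fun x hx v hv => ?_⟩
  obtain ⟨e, he, hce⟩ := hc x hx
  have hv2 : 0 < ‖v‖ ^ 2 := by have := norm_pos_iff.2 hv; positivity
  set B := Metric.ball (x + s • e) (τ * s) with hB
  have hBΩ : B ⊆ Ω := (hball s l hs0 hsl x e he).trans hce
  have hBε : B ⊆ Metric.ball x ε := by
    refine Metric.ball_subset_ball' ?_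
    rw [dist_eq_norm, add_sub_cancel_left, norm_smul, he, Real.norm_of_nonneg hs0.le]
    linarith
  have hxB : x ∉ B := by
    rw [hB, mem_ball_iff_norm, sub_add_cancel_left, norm_neg, norm_smul, he,
      Real.norm_of_nonneg hs0.le]
    nlinarith
  have hfi := integrable_kern_mul_stretch hd hε hJ hh hC hu x (u x)
  set f : E d → ℝ := fun y => kern ε J (y - x) * iteratedDeriv 2 g (stretch (y - x) (u y - u x))
    with hf
  have hfpos : ∀ y ∈ Ω, 0 ≤ f y := by
    intro y hy
    by_cases hyb : y ∈ Metric.ball x ε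
    · by_cases hyx : y = x
      · have : kern ε J (0 : E d) = 0 := by simp [kern]
        simp [hf, hyx, this]
      · have := hS x hx y ⟨hyb, hy⟩ hyx
        rw [sqrt_mul_strain] at this
        exact mul_nonneg (kern_nonneg hε hJ _) (hm.le.trans (hmle _ this))
    · simp [hf, kern_sub_eq_zero hyb]
  have hint : Integrable (fun y => f y * inner ℝ (dyad (dir (y - x)) v) v)
      (volume.restrict Ω) := by
    have h1 := ((integrable_smul_dyad hfi x).apply_continuousLinearMap v).inner_const (𝕜 := ℝ) v
    refine h1.congr (Filter.Eventually.of_forall fun y => ?_)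
    change inner ℝ (f y • dyad (dir (y - x)) v) v = _
    rw [real_inner_smul_left]
  rw [stabilityTensor_eq, inner_integral_smul_dyad hfi]
  calc m * δ / 2 * ‖v‖ ^ 2 < m * (δ * ‖v‖ ^ 2) := by
        have : 0 < m * δ * ‖v‖ ^ 2 := by positivity
        nlinarith
    _ ≤ m * ∫ z in Metric.ball (s • e) (τ * s), kern ε J z * (inner ℝ (dir z) v : ℝ) ^ 2 := by
        gcongr
        exact hδle e v he
    _ = ∫ y in B, m * (kern ε J (y - x) * (inner ℝ (dir (y - x)) v : ℝ) ^ 2) := by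
        rw [integral_const_mul]
        congr 1
        have hpre : (fun y => y - x) ⁻¹' (Metric.ball (s • e) (τ * s)) = B := by
          ext y
          simp only [hB, Set.mem_preimage, mem_ball_iff_norm, sub_sub]
        rw [← hpre]
        exact ((measurePreserving_sub_right volume x).setIntegral_preimage_emb
          (MeasurableEquiv.subRight x).measurableEmbedding
          (fun z => kern ε J z * (inner ℝ (dir z) v : ℝ) ^ 2) _).symm
    _ ≤ ∫ y in B, f y * inner ℝ (dyad (dir (y - x)) v) v := by
        refine setIntegral_mono_on ?_ (IntegrableOn.mono_set hint hBΩ) measurableSet_ball ?_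
        · exact (((integrable_kern_mul_sq hd hε hJ v).comp_sub_right x).const_mul m).integrableOn
        · intro y hy
          have h1 := hS x hx y ⟨hBε hy, hBΩ hy⟩ (fun h => hxB (h ▸ hy))
          rw [sqrt_mul_strain] at h1
          have h2 := hmle _ h1
          rw [inner_dyad_self]
          have h3 := kern_nonneg hε hJ (y - x)
          calc _ = kern ε J (y - x) * m * (inner ℝ (dir (y - x)) v : ℝ) ^ 2 := by ring
            _ ≤ _ := by simp only [hf]; gcongr
    _ ≤ _ := by
        refine setIntegral_mono_set hint ?_ (LE.le.eventuallyLE hBΩ)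
        refine (ae_restrict_iff' hΩ.measurableSet).2 (Filter.Eventually.of_forall fun y hy => ?_)
        simp only [Pi.zero_apply, inner_dyad_self]
        exact mul_nonneg (hfpos y hy) (sq_nonneg _)

end Stability

/-! ### Strain-free displacements are rigid motions. -/

section Rigid

variable {d : ℕ}

lemma mem_rigidMotions_of_skew (A : E d →L[ℝ] E d) (hA : ∀ v, inner ℝ (A v) v = 0) (c : E d) :
    (fun x => A x + c) ∈ rigidMotions d := by
  have hskew u v : inner ℝ (A u) v = -inner ℝ (A v) u := by
    have := hA (u + v)
    simp only [map_add, inner_add_left, inner_add_right, hA] at this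
    linarith
  let Q : Matrix (Fin d) (Fin d) ℝ := Matrix.toEuclideanLin.symm A.toLinearMap
  have hQ x : WithLp.toLp 2 (Q.mulVec x.ofLp) = A x := by
    rw [← Matrix.toLpLin_apply]
    have : Matrix.toEuclideanLin Q = A.toLinearMap := LinearEquiv.apply_symm_apply _ _
    exact congrArg (fun L : E d →ₗ[ℝ] E d => L x) this
  refine ⟨Q, c, ?_, fun x => by rw [hQ]⟩
  have hent i j : Q i j = inner ℝ (A (EuclideanSpace.single j 1)) (EuclideanSpace.single i 1) := by
    rw [← hQ, EuclideanSpace.inner_single_right]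
    simp
  ext i j
  rw [Matrix.transpose_apply, Matrix.neg_apply, hent, hent, hskew]

lemma exists_skew_of_mem_rigidMotions {w : E d → E d} (hw : w ∈ rigidMotions d) :
    ∃ (A : E d →L[ℝ] E d) (c : E d), (∀ v, inner ℝ (A v) v = 0) ∧ ∀ x, w x = A x + c := by
  obtain ⟨Q, c, hQ, h⟩ := hw
  refine ⟨(Matrix.toEuclideanLin Q).toContinuousLinearMap, c, fun v => ?_, fun x => ?_⟩
  · have h1 : inner ℝ (WithLp.toLp 2 (Q.mulVec v.ofLp)) v = v.ofLp ⬝ᵥ Q.mulVec v.ofLp := by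
      rw [EuclideanSpace.inner_eq_star_dotProduct]
      simp
    have h2 : v.ofLp ⬝ᵥ Q.mulVec v.ofLp = -(v.ofLp ⬝ᵥ Q.mulVec v.ofLp) := by
      conv_lhs => rw [Matrix.dotProduct_mulVec, ← Matrix.mulVec_transpose, hQ, Matrix.neg_mulVec,
        neg_dotProduct, dotProduct_comm]
    change inner ℝ (WithLp.toLp 2 (Q.mulVec v.ofLp)) v = 0
    rw [h1]
    linarith
  · rw [h]
    rfl

/-- No differentiability is needed. Subtracting the identities for two base points `x₀`, `x₁`
cancels the term `⟪w y, y⟫`, so `⟪w y, x₁ - x₀⟫` is affine in `y`. The directions with this property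
form a subspace `S`; were it proper, almost every point of `B` would lie in the null set `x₀ + S`.
-/
lemma exists_affine_of_inner_sub_eq_zero {B : Set (E d)} (hB : IsOpen B) (hBne : B.Nonempty)
    {w : E d → E d} (H : ∀ᵐ x ∂volume.restrict B, ∀ᵐ y ∂volume.restrict B,
      inner ℝ (w y - w x) (y - x) = 0) :
    ∃ (A : E d →L[ℝ] E d) (c : E d), ∀ᵐ y ∂volume.restrict B, w y = A y + c := by
  set ν := volume.restrict B with hν
  let S : Submodule ℝ (E d) :=
    { carrier := {v | ∃ (φ : E d →L[ℝ] ℝ) (c : ℝ), ∀ᵐ y ∂ν, inner ℝ (w y) v = φ y + c}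
      zero_mem' := ⟨0, 0, by simp⟩
      add_mem' := by
        rintro v v' ⟨φ, c, h⟩ ⟨φ', c', h'⟩
        refine ⟨φ + φ', c + c', ?_⟩
        filter_upwards [h, h'] with y h1 h2
        rw [inner_add_right, h1, h2, add_apply]
        ring
      smul_mem' := by
        rintro t v ⟨φ, c, h⟩
        refine ⟨t • φ, t * c, ?_⟩
        filter_upwards [h] with y h1
        rw [real_inner_smul_right, h1, smul_apply, smul_eq_mul]
        ring }
  have hdiff : ∀ x₀ x₁ : E d, (∀ᵐ y ∂ν, inner ℝ (w y - w x₀) (y - x₀) = 0) →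
      (∀ᵐ y ∂ν, inner ℝ (w y - w x₁) (y - x₁) = 0) → x₁ - x₀ ∈ S := by
    intro x₀ x₁ h0 h1
    refine ⟨innerSL ℝ (w x₀) - innerSL ℝ (w x₁), inner ℝ (w x₁) x₁ - inner ℝ (w x₀) x₀, ?_⟩
    filter_upwards [h0, h1] with y h0 h1
    simp only [inner_sub_left, inner_sub_right] at h0 h1
    simp only [inner_sub_right, sub_apply, innerSL_apply_apply]
    linarith
  have hBpos : volume B ≠ 0 := (hB.measure_pos volume hBne).ne'
  have hν0 : ν ≠ 0 := by rwa [hν, Ne, Measure.restrict_eq_zero]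
  have hS : S = ⊤ := by
    by_contra hne
    have : (ae ν).NeBot := ae_neBot.2 hν0
    obtain ⟨x₀, hx₀⟩ := H.exists
    have hnull : volume ((fun x => x - x₀) ⁻¹' (S : Set (E d))) = 0 := by
      rw [(measurePreserving_sub_right volume x₀).measure_preimage
        (Submodule.closed_of_finiteDimensional S).measurableSet.nullMeasurableSet]
      exact Measure.addHaar_submodule volume S hne
    have h1 : ∀ᵐ x ∂ν, x ∈ (fun x => x - x₀) ⁻¹' (S : Set (E d)) := by
      filter_upwards [H] with x hx
      exact hdiff x₀ x hx₀ hx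
    have h2 : ∀ᵐ x ∂ν, x ∉ (fun x => x - x₀) ⁻¹' (S : Set (E d)) :=
      ae_restrict_of_ae (measure_eq_zero_iff_ae_notMem.1 hnull)
    obtain ⟨x, hx, hx'⟩ := (h1.and h2).exists
    exact hx' hx
  let b := EuclideanSpace.basisFun (Fin d) ℝ
  have hb i : b i ∈ S := by rw [hS]; trivial
  choose φ c hφ using hb
  refine ⟨∑ i, (φ i).smulRight (b i), ∑ i, c i • b i, ?_⟩
  filter_upwards [ae_all_iff.2 hφ] with y hy
  rw [← b.sum_repr' (w y), sum_apply, ← Finset.sum_add_distrib]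
  refine Finset.sum_congr rfl fun i _ => ?_
  rw [real_inner_comm, hy i, add_smul, ContinuousLinearMap.smulRight_apply]

/-- For affine `w` the strain identity is `⟪A (y - x), y - x⟫ = 0`. It extends by continuity from
almost every to every `y` in `B`, and small multiples of any `v` occur as `y - x`. -/
lemma exists_skew_of_inner_sub_eq_zero {B : Set (E d)} (hB : IsOpen B) (hBne : B.Nonempty)
    {w : E d → E d} (H : ∀ᵐ x ∂volume.restrict B, ∀ᵐ y ∂volume.restrict B,
      inner ℝ (w y - w x) (y - x) = 0) :
    ∃ (A : E d →L[ℝ] E d) (c : E d), (∀ v, inner ℝ (A v) v = 0) ∧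
      ∀ᵐ y ∂volume.restrict B, w y = A y + c := by
  obtain ⟨A, c, hA⟩ := exists_affine_of_inner_sub_eq_zero hB hBne H
  refine ⟨A, c, fun v => ?_, hA⟩
  have hBpos : volume B ≠ 0 := (hB.measure_pos volume hBne).ne'
  have : (ae (volume.restrict B)).NeBot :=
    ae_neBot.2 (by rwa [Ne, Measure.restrict_eq_zero])
  obtain ⟨x, ⟨hx, hxA⟩, hxB⟩ := ((H.and hA).and (ae_restrict_mem hB.measurableSet)).exists
  have h1 : (fun y => inner ℝ (A (y - x)) (y - x)) =ᵐ[volume.restrict B] fun _ => (0 : ℝ) := by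
    filter_upwards [hx, hA] with y hy hyA
    rw [hyA, hxA] at hy
    rw [map_sub]
    simpa using hy
  have h2 : Set.EqOn (fun y => inner ℝ (A (y - x)) (y - x)) (fun _ => (0 : ℝ)) B :=
    Measure.eqOn_open_of_ae_eq h1 hB (by fun_prop) (by fun_prop)
  have h3 : ∀ᶠ t : ℝ in nhdsWithin 0 {0}ᶜ, x + t • v ∈ B := by
    refine Filter.Eventually.filter_mono nhdsWithin_le_nhds ?_
    have hc : Continuous fun t : ℝ => x + t • v := by fun_prop
    exact hc.continuousAt.eventually_mem (hB.mem_nhds (by simpa using hxB))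
  obtain ⟨t, ht, ht0⟩ := (h3.and self_mem_nhdsWithin).exists
  have h4 := h2 ht
  simp only [add_sub_cancel_left, map_smul, real_inner_smul_left, real_inner_smul_right] at h4
  have ht0' : t ≠ 0 := ht0
  simpa [ht0'] using h4

/-- Uniqueness of the affine data on overlaps is what permits gluing the local rigid motions. -/
lemma affine_eq_of_ae_eq {U : Set (E d)} (hU : IsOpen U) (hne : U.Nonempty) {w : E d → E d}
    {A A' : E d →L[ℝ] E d} {c c' : E d} (h : ∀ᵐ y ∂volume.restrict U, w y = A y + c)
    (h' : ∀ᵐ y ∂volume.restrict U, w y = A' y + c') : (A, c) = (A', c') := by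
  have h1 : (fun y => A y + c) =ᵐ[volume.restrict U] fun y => A' y + c' := by
    filter_upwards [h, h'] with y h1 h2
    rw [← h1, h2]
  have h2 : Set.EqOn (fun y => A y + c) (fun y => A' y + c') U :=
    Measure.eqOn_open_of_ae_eq h1 hU (by fun_prop) (by fun_prop)
  obtain ⟨x, hx⟩ := hne
  have hA : A = A' := by
    ext1 v
    have hc : Continuous fun t : ℝ => x + t • v := by fun_prop
    have h3 : ∀ᶠ t : ℝ in nhdsWithin 0 {0}ᶜ, x + t • v ∈ U :=
      Filter.Eventually.filter_mono nhdsWithin_le_nhds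
        (hc.continuousAt.eventually_mem (hU.mem_nhds (by simpa using hx)))
    obtain ⟨t, ht, ht0⟩ := (h3.and self_mem_nhdsWithin).exists
    have ht0' : t ≠ 0 := ht0
    have h4 := h2 ht
    have h5 := h2 hx
    simp only [map_add, map_smul] at h4 h5
    have h6 : t • A v = t • A' v := by
      have : (A x + t • A v + c) - (A x + c) = (A' x + t • A' v + c') - (A' x + c') := by
        rw [h4, h5]
      have e1 : (A x + t • A v + c) - (A x + c) = t • A v := by abel
      have e2 : (A' x + t • A' v + c') - (A' x + c') = t • A' v := by abel
      rwa [e1, e2] at this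
    exact smul_right_injective _ ht0' h6
  subst hA
  have h5 := h2 hx
  simpa using h5

/-- A displacement field without strain on a connected open set is a rigid motion. -/
theorem exists_rigidMotion_ae_eq {Ω : Set (E d)} (hΩ : IsOpen Ω) (hconn : IsConnected Ω) {ε : ℝ}
    (hε : 0 < ε) {w : E d → E d}
    (H : ∀ᵐ x ∂volume.restrict Ω, ∀ᵐ y ∂volume.restrict Ω, ‖y - x‖ < ε →
      inner ℝ (w y - w x) (y - x) = 0) :
    ∃ π ∈ rigidMotions d, w =ᵐ[volume.restrict Ω] π := by
  have hloc : ∀ z ∈ Ω, ∃ r : ℝ, ∃ q : (E d →L[ℝ] E d) × E d, 0 < r ∧ Metric.ball z r ⊆ Ω ∧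
      (∀ v, inner ℝ (q.1 v) v = 0) ∧
      ∀ᵐ y ∂volume.restrict (Metric.ball z r), w y = q.1 y + q.2 := by
    intro z hz
    obtain ⟨r₀, hr₀, hsub₀⟩ := Metric.isOpen_iff.1 hΩ z hz
    -- Any two points of the ball are then joined by a bond shorter than `ε`.
    set r := min r₀ (ε / 2) with hr
    have hr0 : 0 < r := lt_min hr₀ (half_pos hε)
    have hsub : Metric.ball z r ⊆ Ω := (Metric.ball_subset_ball (min_le_left _ _)).trans hsub₀
    obtain ⟨A, c, h1, h2⟩ := exists_skew_of_inner_sub_eq_zero (w := w)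
      (Metric.isOpen_ball (x := z) (ε := r)) ⟨z, Metric.mem_ball_self hr0⟩ (by
        filter_upwards [ae_restrict_of_ae_restrict_of_subset hsub H,
          ae_restrict_mem measurableSet_ball] with x hx hxB
        filter_upwards [ae_restrict_of_ae_restrict_of_subset hsub hx,
          ae_restrict_mem measurableSet_ball] with y hy hyB
        refine hy ?_
        rw [← dist_eq_norm]
        have t1 := dist_triangle_right y x z
        rw [Metric.mem_ball] at hxB hyB
        have := min_le_right r₀ (ε / 2)
        linarith)
    exact ⟨r, (A, c), hr0, hsub, h1, h2⟩
  choose! r q hr hsub hskew hq using hloc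
  have huniq : ∀ z ∈ Ω, ∀ z' ∈ Ω, ∀ y ∈ Metric.ball z (r z), y ∈ Metric.ball z' (r z') →
      q z = q z' := by
    intro z hz z' hz' y hy hy'
    refine affine_eq_of_ae_eq (w := w) (Metric.isOpen_ball.inter Metric.isOpen_ball) ⟨y, hy, hy'⟩
      (ae_restrict_of_ae_restrict_of_subset Set.inter_subset_left (hq z hz))
      (ae_restrict_of_ae_restrict_of_subset Set.inter_subset_right (hq z' hz'))
  obtain ⟨z₀, hz₀⟩ := hconn.nonempty
  -- Balls with the data `q z₀` and balls with other data form disjoint open sets covering `Ω`;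
  -- connectedness leaves only the first.
  set U : Set (E d) := ⋃ z ∈ {z ∈ Ω | q z = q z₀}, Metric.ball z (r z) with hU
  set U' : Set (E d) := ⋃ z ∈ {z ∈ Ω | q z ≠ q z₀}, Metric.ball z (r z) with hU'
  have hΩU : Ω ⊆ U := by
    refine IsPreconnected.subset_left_of_subset_union (u := U) (v := U')
      (isOpen_biUnion fun _ _ => Metric.isOpen_ball) (isOpen_biUnion fun _ _ => Metric.isOpen_ball)
      ?_ ?_ ?_ hconn.isPreconnected
    · rw [Set.disjoint_left]
      intro y hy hy'
      simp only [hU, hU', Set.mem_iUnion, exists_prop] at hy hy'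
      obtain ⟨z, ⟨hz, hzq⟩, hyz⟩ := hy
      obtain ⟨z', ⟨hz', hzq'⟩, hyz'⟩ := hy'
      exact hzq' ((huniq z hz z' hz' y hyz hyz').symm.trans hzq)
    · intro z hz
      by_cases h : q z = q z₀
      · exact Or.inl (Set.mem_biUnion (x := z) ⟨hz, h⟩ (Metric.mem_ball_self (hr z hz)))
      · exact Or.inr (Set.mem_biUnion (x := z) ⟨hz, h⟩ (Metric.mem_ball_self (hr z hz)))
    · exact ⟨z₀, hz₀, Set.mem_biUnion (x := z₀) ⟨hz₀, rfl⟩ (Metric.mem_ball_self (hr z₀ hz₀))⟩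
  refine ⟨_, mem_rigidMotions_of_skew (q z₀).1 (hskew z₀ hz₀) (q z₀).2, ?_⟩
  rw [Filter.EventuallyEq, ae_restrict_iff' hΩ.measurableSet, ae_iff]
  refine measure_null_of_locally_null _ fun x hx => ?_
  simp only [Set.mem_ofPred_eq, Classical.not_imp] at hx
  obtain ⟨z, ⟨hz, hzq⟩, hxz⟩ := Set.mem_iUnion₂.1 (hΩU hx.1)
  refine ⟨_, Filter.inter_mem (mem_nhdsWithin_of_mem_nhds (Metric.isOpen_ball.mem_nhds hxz))
    self_mem_nhdsWithin, ?_⟩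
  have h1 := hq z hz
  rw [ae_restrict_iff' measurableSet_ball, ae_iff] at h1
  refine measure_mono_null ?_ h1
  rintro y ⟨hy1, hy2⟩
  simp only [Set.mem_ofPred_eq, Classical.not_imp] at hy2 ⊢
  rw [hzq]
  exact ⟨hy1, hy2.2⟩

end Rigid

/-! ### Symmetrization over bonds and triviality of the kernel. -/

section Symmetry

variable {d : ℕ} {ε : ℝ} {J : ℝ → ℝ} {Ω : Set (E d)}

/-- This is the integrand of a convolution of two integrable functions, with the base measure shrunk
from `volume` to `μ`. -/
lemma integrable_prod_mul_fst {μ : Measure (E d)} [SFinite μ] (hμ : μ ≤ volume) {k f : E d → ℝ}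
    (hk : Integrable k) (hf : Integrable f μ) :
    Integrable (fun q : E d × E d => k (q.2 - q.1) * f q.1) (μ.prod μ) := by
  have h := hf.convolution_integrand (ContinuousLinearMap.mul ℝ ℝ) hk
  have h2 := (h.mono_measure (Measure.prod_mono hμ le_rfl)).swap
  refine h2.congr (Filter.Eventually.of_forall fun q => ?_)
  simp [mul_comm]

lemma integrable_prod_mul_snd {μ : Measure (E d)} [SFinite μ] (hμ : μ ≤ volume) {k f : E d → ℝ}
    (hk : Integrable k) (hf : Integrable f μ) :
    Integrable (fun q : E d × E d => k (q.2 - q.1) * f q.2) (μ.prod μ) := by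
  have h := (integrable_prod_mul_fst hμ hk.comp_neg hf).swap
  refine h.congr (Filter.Eventually.of_forall fun q => ?_)
  simp

lemma aemeasurable_bond_weight {μ : Measure (E d)} [SFinite μ] (hJ : IsInfluenceFunction J)
    {h : ℝ → ℝ} (hh : Measurable h) {u : E d → E d} (hu : AEStronglyMeasurable u μ) :
    AEMeasurable (fun q : E d × E d =>
      kern ε J (q.2 - q.1) * h (stretch (q.2 - q.1) (u q.2 - u q.1))) (μ.prod μ) := by
  refine aemeasurable_kern_mul_stretch hJ hh (by fun_prop) ?_
  exact hu.comp_snd.aemeasurable.sub hu.comp_fst.aemeasurable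

/-- Integration by parts for symmetric pairwise interactions. -/
lemma integral_inner_integral_smul_dir {μ : Measure (E d)} [SFinite μ] {κ : E d → E d → ℝ}
    (hsymm : ∀ x y, κ y x = κ x y) {w : E d → E d}
    (hi₁ : ∀ᵐ x ∂μ, Integrable (fun y => κ x y • dir (y - x)) μ)
    (hi₂ : Integrable (fun q : E d × E d => κ q.1 q.2 * inner ℝ (dir (q.2 - q.1)) (w q.1))
      (μ.prod μ)) :
    Integrable (fun q : E d × E d => κ q.1 q.2 * inner ℝ (dir (q.2 - q.1)) (w q.2 - w q.1))
      (μ.prod μ) ∧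
    2 * ∫ x, inner ℝ (∫ y, κ x y • dir (y - x) ∂μ) (w x) ∂μ =
      -∫ q, κ q.1 q.2 * inner ℝ (dir (q.2 - q.1)) (w q.2 - w q.1) ∂(μ.prod μ) := by
  set f : E d × E d → ℝ := fun q => κ q.1 q.2 * inner ℝ (dir (q.2 - q.1)) (w q.1) with hf
  -- Exchanging the ends of a bond keeps `κ` and reverses `dir`; averaging the two orders produces
  -- the difference of `w`.
  have hs : ∀ q : E d × E d, κ q.1 q.2 * inner ℝ (dir (q.2 - q.1)) (w q.2 - w q.1) =
      -(f q.swap + f q) := by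
    rintro ⟨x, y⟩
    have : dir (x - y) = -dir (y - x) := by rw [← dir_neg, neg_sub]
    simp only [hf, Prod.swap_prod_mk, hsymm x y, this, inner_sub_right, inner_neg_left]
    ring
  have hsw : Integrable (fun q : E d × E d => f q.swap) (μ.prod μ) := hi₂.swap
  have hint : ∫ q, f q.swap ∂(μ.prod μ) = ∫ q, f q ∂(μ.prod μ) := integral_prod_swap f
  have h1 : ∫ x, inner ℝ (∫ y, κ x y • dir (y - x) ∂μ) (w x) ∂μ = ∫ q, f q ∂(μ.prod μ) := by
    rw [integral_prod f hi₂]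
    refine integral_congr_ae ?_
    filter_upwards [hi₁] with x hx
    rw [real_inner_comm, ← integral_inner hx]
    simp only [hf, real_inner_smul_right, real_inner_comm]
  simp only [hs]
  refine ⟨(hsw.add hi₂).neg, ?_⟩
  rw [integral_neg, integral_add hsw hi₂, hint, h1]
  ring

lemma inner_dir_rigidMotion_sub {π : E d → E d} (hπ : π ∈ rigidMotions d) (x y : E d) :
    inner ℝ (dir (y - x)) (π y - π x) = 0 := by
  obtain ⟨A, c, hA, h⟩ := exists_skew_of_mem_rigidMotions hπ
  rw [h, h, add_sub_add_right_eq_sub, ← map_sub, dir, real_inner_smul_left, real_inner_comm, hA,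
    mul_zero]

lemma continuous_of_mem_rigidMotions {π : E d → E d} (hπ : π ∈ rigidMotions d) :
    Continuous π := by
  obtain ⟨A, c, hA, h⟩ := exists_skew_of_mem_rigidMotions hπ
  rw [funext h]
  fun_prop

lemma exists_norm_rigidMotion_le (hb : Bornology.IsBounded Ω) {π : E d → E d}
    (hπ : π ∈ rigidMotions d) : ∃ C : ℝ, 0 ≤ C ∧ ∀ x ∈ Ω, ‖π x‖ ≤ C := by
  obtain ⟨C, hC⟩ := (hb.isCompact_closure.image (continuous_of_mem_rigidMotions hπ)).isBounded
    |>.exists_norm_le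
  refine ⟨max C 0, le_max_right _ _, fun x hx => ?_⟩
  exact (hC _ ⟨x, subset_closure hx, rfl⟩).trans (le_max_left _ _)

/-- Pairwise forces along bonds are orthogonal to rigid motions. -/
lemma integral_inner_rigidMotion_eq_zero [IsFiniteMeasure (volume.restrict Ω)]
    (hΩ : MeasurableSet Ω) (hb : Bornology.IsBounded Ω) {κ : E d → E d → ℝ}
    (hsymm : ∀ x y, κ y x = κ x y)
    (hmeas : AEMeasurable (fun q : E d × E d => κ q.1 q.2)
      ((volume.restrict Ω).prod (volume.restrict Ω)))
    {k : E d → ℝ} (hk : Integrable k)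
    (hκ : ∀ᵐ q ∂((volume.restrict Ω).prod (volume.restrict Ω)), |κ q.1 q.2| ≤ k (q.2 - q.1))
    {π : E d → E d} (hπ : π ∈ rigidMotions d) :
    ∫ x in Ω, inner ℝ (∫ y in Ω, κ x y • dir (y - x)) (π x) = 0 := by
  set μ := volume.restrict Ω with hμ
  obtain ⟨C, hC0, hC⟩ := exists_norm_rigidMotion_le hb hπ
  have hdir : Measurable fun q : E d × E d => dir (q.2 - q.1) := measurable_dir.comp (by fun_prop)
  have hkint : Integrable (fun q : E d × E d => k (q.2 - q.1)) (μ.prod μ) := by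
    have := integrable_prod_mul_fst (μ := μ) Measure.restrict_le_self hk (integrable_const 1)
    simpa using this
  have hvec : Integrable (fun q : E d × E d => κ q.1 q.2 • dir (q.2 - q.1)) (μ.prod μ) := by
    refine hkint.mono' (hmeas.smul hdir.aemeasurable).aestronglyMeasurable ?_
    filter_upwards [hκ] with q hq
    rw [norm_smul, Real.norm_eq_abs]
    exact (mul_le_of_le_one_right (abs_nonneg _) (norm_dir_le _)).trans hq
  have hπm : Measurable fun q : E d × E d => π q.1 :=
    (continuous_of_mem_rigidMotions hπ).measurable.comp measurable_fst
  have hfst : ∀ᵐ q ∂(μ.prod μ), q.1 ∈ Ω :=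
    Measure.quasiMeasurePreserving_fst.ae (ae_restrict_mem hΩ)
  have hi₂ : Integrable (fun q : E d × E d => κ q.1 q.2 * inner ℝ (dir (q.2 - q.1)) (π q.1))
      (μ.prod μ) := by
    refine (hkint.mul_const C).mono'
      (hmeas.mul (hdir.inner hπm).aemeasurable).aestronglyMeasurable ?_
    filter_upwards [hκ, hfst] with q hq hq1
    rw [norm_mul, Real.norm_eq_abs]
    have h1 : ‖(inner ℝ (dir (q.2 - q.1)) (π q.1) : ℝ)‖ ≤ 1 * C :=
      (norm_inner_le_norm _ _).trans (by gcongr; exacts [norm_dir_le _, hC _ hq1])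
    rw [one_mul] at h1
    have := (abs_nonneg (κ q.1 q.2)).trans hq
    gcongr
  have h := (integral_inner_integral_smul_dir hsymm hvec.prod_right_ae hi₂).2
  simp only [inner_dir_rigidMotion_sub hπ, mul_zero, integral_zero, neg_zero] at h
  linarith

/-- The weight of a bond in the linearized force. -/
def bondWeight (ε : ℝ) (J h : ℝ → ℝ) (u : E d → E d) (x y : E d) : ℝ :=
  kern ε J (y - x) * h (stretch (y - x) (u y - u x))

lemma bondWeight_symm (h : ℝ → ℝ) (u : E d → E d) (x y : E d) :
    bondWeight ε J h u y x = bondWeight ε J h u x y := by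
  rw [bondWeight, bondWeight, ← neg_sub y x, ← neg_sub (u y) (u x), kern_neg, stretch_neg_neg]

lemma abs_bondWeight_le (hε : 0 < ε) (hJ : IsInfluenceFunction J) {h : ℝ → ℝ} {C : ℝ}
    (hC : ∀ r, |h r| ≤ C) (u : E d → E d) (x y : E d) :
    |bondWeight ε J h u x y| ≤ C * kern ε J (y - x) := by
  have hk := kern_nonneg hε hJ (y - x)
  rw [bondWeight, abs_mul, abs_of_nonneg hk, mul_comm]
  gcongr
  exact hC _

lemma forceDeriv_eq_neg_integral_smul_dir (g : ℝ → ℝ) (u w : E d → E d) (x : E d) :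
    forceDeriv Ω ε J g u w x = -∫ y in Ω,
      (2 * bondWeight ε J (iteratedDeriv 2 g) u x y * inner ℝ (dir (y - x)) (w y - w x)) •
        dir (y - x) := by
  rw [forceDeriv_eq]
  simp only [dyad_apply, smul_smul, bondWeight]

lemma bondWeight_pos (hε : 0 < ε) (hJ : IsInfluenceFunction J) {g : ℝ → ℝ} {re rc : ℝ}
    (hg : IsCohesivePotential g re rc) {u : E d → E d}
    (huS : StrictlyInsideStrengthDomain Ω ε re rc u) {x y : E d} (hx : x ∈ Ω) (hy : y ∈ Ω)
    (hxy : ‖y - x‖ < ε) (hne : y ≠ x) : 0 < bondWeight ε J (iteratedDeriv 2 g) u x y := by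
  obtain ⟨a, b, ha, hb, hS⟩ := huS
  have h1 := hS x hx y ⟨by rwa [mem_ball_iff_norm], hy⟩ hne
  rw [sqrt_mul_strain] at h1
  exact mul_pos (kern_pos hε hJ (sub_ne_zero.2 hne) hxy)
    (hg.second_deriv_pos _ ⟨ha.trans_le h1.1, h1.2.trans_lt hb⟩)

lemma bondWeight_nonneg (hε : 0 < ε) (hJ : IsInfluenceFunction J) {g : ℝ → ℝ} {re rc : ℝ}
    (hg : IsCohesivePotential g re rc) {u : E d → E d}
    (huS : StrictlyInsideStrengthDomain Ω ε re rc u) {x y : E d} (hx : x ∈ Ω) (hy : y ∈ Ω) :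
    0 ≤ bondWeight ε J (iteratedDeriv 2 g) u x y := by
  by_cases hne : y = x
  · have : kern ε J (0 : E d) = 0 := by simp [kern]
    simp [bondWeight, hne, this]
  by_cases hxy : ‖y - x‖ < ε
  · exact (bondWeight_pos hε hJ hg huS hx hy hxy hne).le
  · rw [bondWeight, kern_eq_zero (by simpa using hxy), zero_mul]

/-- The linearized force has no kernel in the orthogonal complement of the rigid motions. -/
theorem ae_eq_zero_of_forceDeriv_ae_eq_zero (hd : 2 ≤ d) (hΩ : IsOpen Ω) (hconn : IsConnected Ω)
    [IsFiniteMeasure (volume.restrict Ω)]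
    (hε : 0 < ε) (hJ : IsInfluenceFunction J) {g : ℝ → ℝ} {re rc : ℝ}
    (hg : IsCohesivePotential g re rc) {u : E d → E d}
    (hu : AEStronglyMeasurable u (volume.restrict Ω))
    (huS : StrictlyInsideStrengthDomain Ω ε re rc u) {w : E d → E d}
    (hw : MemLp w 2 (volume.restrict Ω))
    (horth : ∀ π ∈ rigidMotions d, ∫ x in Ω, inner ℝ (w x) (π x) = 0)
    (hker : forceDeriv Ω ε J g u w =ᵐ[volume.restrict Ω] 0) :
    w =ᵐ[volume.restrict Ω] 0 := by
  set μ := volume.restrict Ω with hμ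
  have hμle : μ ≤ volume := Measure.restrict_le_self
  obtain ⟨C, hC⟩ := hg.bounded 2 (by norm_num)
  have hC0 : 0 ≤ C := (abs_nonneg _).trans (hC 0)
  have hh : Measurable (iteratedDeriv 2 g) :=
    (hg.differentiable 2 (by norm_num)).continuous.measurable
  set c := bondWeight ε J (iteratedDeriv 2 g) u with hc
  set κ : E d → E d → ℝ := fun x y => 2 * c x y * inner ℝ (dir (y - x)) (w y - w x) with hκ
  have hk := integrable_kern (d := d) hd hε hJ
  have hsymm : ∀ x y, κ y x = κ x y := by
    intro x y
    have h1 : dir (x - y) = -dir (y - x) := by rw [← dir_neg, neg_sub]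
    have h2 : w x - w y = -(w y - w x) := (neg_sub _ _).symm
    simp only [hκ, hc, bondWeight_symm _ u x y, h1, h2, inner_neg_neg]
  have hdir : Measurable fun q : E d × E d => dir (q.2 - q.1) := measurable_dir.comp (by fun_prop)
  have hw1 : AEMeasurable (fun q : E d × E d => w q.1) (μ.prod μ) := hw.1.comp_fst.aemeasurable
  have hw2 : AEMeasurable (fun q : E d × E d => w q.2) (μ.prod μ) := hw.1.comp_snd.aemeasurable
  have hcm : AEMeasurable (fun q : E d × E d => c q.1 q.2) (μ.prod μ) :=
    aemeasurable_bond_weight hJ hh hu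
  have hκm : AEMeasurable (fun q : E d × E d => κ q.1 q.2) (μ.prod μ) :=
    (hcm.const_mul 2).mul (hdir.aemeasurable.inner (hw2.sub hw1))
  have hκle : ∀ x y, |κ x y| ≤ 2 * C * (kern ε J (y - x) * (‖w y‖ + ‖w x‖)) := by
    intro x y
    have h1 := abs_bondWeight_le hε hJ hC u x y
    have h2 : |inner ℝ (dir (y - x)) (w y - w x)| ≤ 1 * (‖w y‖ + ‖w x‖) :=
      (abs_real_inner_le_norm _ _).trans
        (mul_le_mul (norm_dir_le _) (norm_sub_le _ _) (norm_nonneg _) zero_le_one)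
    have h3 : 0 ≤ C * kern ε J (y - x) := (abs_nonneg _).trans h1
    simp only [hκ, abs_mul, abs_two]
    calc _ ≤ 2 * (C * kern ε J (y - x)) * (1 * (‖w y‖ + ‖w x‖)) := by gcongr
      _ = _ := by ring
  have hwn : Integrable (fun x => ‖w x‖) μ := (hw.integrable one_le_two).norm
  have hwn2 : Integrable (fun x => ‖w x‖ ^ 2) μ := hw.integrable_norm_pow two_ne_zero
  have hvec : Integrable (fun q : E d × E d => κ q.1 q.2 • dir (q.2 - q.1)) (μ.prod μ) := by
    refine (((integrable_prod_mul_snd hμle hk hwn).add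
      (integrable_prod_mul_fst hμle hk hwn)).const_mul (2 * C)).mono'
      (hκm.smul hdir.aemeasurable).aestronglyMeasurable (Filter.Eventually.of_forall fun q => ?_)
    rw [norm_smul, Real.norm_eq_abs]
    refine (mul_le_of_le_one_right (abs_nonneg _) (norm_dir_le _)).trans ((hκle _ _).trans_eq ?_)
    simp only [Pi.add_apply]
    ring
  have hi₂ : Integrable (fun q : E d × E d => κ q.1 q.2 * inner ℝ (dir (q.2 - q.1)) (w q.1))
      (μ.prod μ) := by
    refine (((integrable_prod_mul_snd hμle hk hwn2).add
      ((integrable_prod_mul_fst hμle hk hwn2).const_mul 2)).const_mul (2 * C)).mono'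
      (hκm.mul (hdir.aemeasurable.inner hw1)).aestronglyMeasurable
      (Filter.Eventually.of_forall fun q => ?_)
    rw [norm_mul, Real.norm_eq_abs, Real.norm_eq_abs]
    have h1 : |inner ℝ (dir (q.2 - q.1)) (w q.1)| ≤ 1 * ‖w q.1‖ :=
      (abs_real_inner_le_norm _ _).trans (by gcongr; exact norm_dir_le _)
    have h2 := hκle q.1 q.2
    have hk0 := kern_nonneg hε hJ (q.2 - q.1)
    -- Young's inequality decouples the product, so square integrability of `w` is enough and the
    -- kernel statement reaches the `L²` closure.
    have h3 : (‖w q.2‖ + ‖w q.1‖) * ‖w q.1‖ ≤ ‖w q.2‖ ^ 2 + 2 * ‖w q.1‖ ^ 2 := by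
      nlinarith [sq_nonneg (‖w q.2‖ - ‖w q.1‖), sq_nonneg ‖w q.1‖, sq_nonneg ‖w q.2‖]
    calc _ ≤ 2 * C * (kern ε J (q.2 - q.1) * (‖w q.2‖ + ‖w q.1‖)) * (1 * ‖w q.1‖) := by gcongr
      _ = 2 * C * kern ε J (q.2 - q.1) * ((‖w q.2‖ + ‖w q.1‖) * ‖w q.1‖) := by ring
      _ ≤ 2 * C * kern ε J (q.2 - q.1) * (‖w q.2‖ ^ 2 + 2 * ‖w q.1‖ ^ 2) := by gcongr
      _ = _ := by simp only [Pi.add_apply]; ring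
  obtain ⟨hFint, hF⟩ := integral_inner_integral_smul_dir hsymm hvec.prod_right_ae hi₂
  have hzero : ∫ x, inner ℝ (∫ y, κ x y • dir (y - x) ∂μ) (w x) ∂μ = 0 := by
    refine integral_eq_zero_of_ae ?_
    filter_upwards [hker] with x hx
    rw [forceDeriv_eq_neg_integral_smul_dir, Pi.zero_apply, neg_eq_zero] at hx
    rw [hx, inner_zero_left, Pi.zero_apply]
  rw [hzero, mul_zero, eq_comm, neg_eq_zero] at hF
  have hmem : ∀ᵐ q ∂(μ.prod μ), q.1 ∈ Ω ∧ q.2 ∈ Ω :=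
    (Measure.quasiMeasurePreserving_fst.ae (ae_restrict_mem hΩ.measurableSet)).and
      (Measure.quasiMeasurePreserving_snd.ae (ae_restrict_mem hΩ.measurableSet))
  have hnn : 0 ≤ᵐ[μ.prod μ] fun q : E d × E d =>
      κ q.1 q.2 * inner ℝ (dir (q.2 - q.1)) (w q.2 - w q.1) := by
    filter_upwards [hmem] with q hq
    have := bondWeight_nonneg hε hJ hg huS hq.1 hq.2
    simp only [hκ, Pi.zero_apply, mul_assoc]
    have := mul_self_nonneg (inner ℝ (dir (q.2 - q.1)) (w q.2 - w q.1))
    positivity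
  rw [integral_eq_zero_iff_of_nonneg_ae hnn hFint] at hF
  -- A nonnegative integrand with zero integral vanishes a.e.; the weight is positive on bonds
  -- shorter than `ε`, so the strain itself vanishes there.
  have hstrain : ∀ᵐ q ∂(μ.prod μ), ‖q.2 - q.1‖ < ε →
      inner ℝ (w q.2 - w q.1) (q.2 - q.1) = 0 := by
    filter_upwards [hF, hmem] with q hq hq' hlt
    by_cases hne : q.2 = q.1
    · simp [hne]
    have hpos := bondWeight_pos hε hJ hg huS hq'.1 hq'.2 hlt hne
    simp only [hκ, Pi.zero_apply, mul_eq_zero, hc, hpos.ne', OfNat.ofNat_ne_zero, false_or,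
      or_self] at hq
    rw [← norm_smul_dir (q.2 - q.1), real_inner_smul_right, real_inner_comm, hq, mul_zero]
  obtain ⟨π, hπ, hwπ⟩ := exists_rigidMotion_ae_eq hΩ hconn hε (Measure.ae_ae_of_ae_prod hstrain)
  have h1 := horth π hπ
  -- `w` equals the rigid motion `π` and is orthogonal to it, hence orthogonal to itself.
  have h2 : ∫ x, ‖w x‖ ^ 2 ∂μ = 0 := by
    rw [← h1]
    refine integral_congr_ae ?_
    filter_upwards [hwπ] with x hx
    rw [← hx, real_inner_self_eq_norm_sq]
  rw [integral_eq_zero_iff_of_nonneg (fun x => by positivity) hwn2] at h2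
  filter_upwards [h2] with x hx
  simpa using hx

end Symmetry

/-! ### Stability of finite rank under sums and multiples. -/

section FiniteRank

variable {X : Type*} [AddCommGroup X] [Module ℝ X]

lemma finiteDimensional_range_add {f g : X →ₗ[ℝ] X}
    (hf : FiniteDimensional ℝ (LinearMap.range f)) (hg : FiniteDimensional ℝ (LinearMap.range g)) :
    FiniteDimensional ℝ (LinearMap.range (f + g)) := by
  have : LinearMap.range (f + g) ≤ LinearMap.range f ⊔ LinearMap.range g := by
    rintro _ ⟨x, rfl⟩
    exact Submodule.add_mem_sup ⟨x, rfl⟩ ⟨x, rfl⟩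
  exact Submodule.finiteDimensional_of_le this

lemma finiteDimensional_range_smul {f : X →ₗ[ℝ] X}
    (hf : FiniteDimensional ℝ (LinearMap.range f)) (c : ℝ) :
    FiniteDimensional ℝ (LinearMap.range (c • f)) := by
  have : LinearMap.range (c • f) ≤ LinearMap.range f := by
    rintro _ ⟨x, rfl⟩
    exact ⟨c • x, by simp⟩
  exact Submodule.finiteDimensional_of_le this

lemma finiteDimensional_range_sum {ι : Type*} (t : Finset ι) (f : ι → X →ₗ[ℝ] X)
    (hf : ∀ i ∈ t, FiniteDimensional ℝ (LinearMap.range (f i))) :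
    FiniteDimensional ℝ (LinearMap.range (∑ i ∈ t, f i)) := by
  classical
  induction t using Finset.induction_on with
  | empty =>
    rw [Finset.sum_empty, LinearMap.range_zero]
    infer_instance
  | insert i t hi ih =>
    rw [Finset.sum_insert hi]
    exact finiteDimensional_range_add (hf i (Finset.mem_insert_self i t))
      (ih fun j hj => hf j (Finset.mem_insert_of_mem hj))

end FiniteRank

/-! ### Multiplication and kernel operators on `L^∞`. -/

section Operators

variable {α H : Type*} [MeasurableSpace α] {μ : Measure α} [NormedAddCommGroup H]
  [NormedSpace ℝ H]

lemma exists_mulOp {a : α → H →L[ℝ] H} (ha : AEStronglyMeasurable a μ) {c : ℝ} (hc : 0 ≤ c)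
    (hac : ∀ᵐ x ∂μ, ∀ v, ‖a x v‖ ≤ c * ‖v‖) :
    ∃ T : Lp H ∞ μ →L[ℝ] Lp H ∞ μ, ‖T‖ ≤ c ∧ ∀ u, T u =ᵐ[μ] fun x => a x (u x) := by
  refine exists_continuousLinearMap_Linfty (fun u x => a x (u x)) hc (fun u => ?_) (fun u => ?_)
    (fun u v => ?_) (fun t u => ?_)
  · exact (ContinuousLinearMap.apply ℝ H).flip.aestronglyMeasurable_comp₂ ha
      (Lp.aestronglyMeasurable u)
  · filter_upwards [hac, ae_norm_le_norm_Linfty u] with x h1 h2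
    exact (h1 _).trans (by gcongr)
  · filter_upwards [Lp.coeFn_add u v] with x hx
    rw [hx, Pi.add_apply, Pi.add_apply, map_add]
  · filter_upwards [Lp.coeFn_smul t u] with x hx
    rw [hx, Pi.smul_apply, Pi.smul_apply, map_smul]

lemma aestronglyMeasurable_clm_apply {θ : α → H →L[ℝ] H} (hθ : AEStronglyMeasurable θ μ)
    {u : α → H} (hu : AEStronglyMeasurable u μ) : AEStronglyMeasurable (fun y => θ y (u y)) μ :=
  (ContinuousLinearMap.apply ℝ H).flip.aestronglyMeasurable_comp₂ hθ hu

lemma integrable_clm_apply {θ : α → H →L[ℝ] H} (hθ : Integrable θ μ) (u : Lp H ∞ μ) :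
    Integrable (fun y => θ y (u y)) μ := by
  refine (hθ.norm.mul_const ‖u‖).mono'
    (aestronglyMeasurable_clm_apply hθ.1 (Lp.aestronglyMeasurable u)) ?_
  filter_upwards [ae_norm_le_norm_Linfty u] with y hy
  exact (θ y).le_opNorm_of_le hy

lemma norm_integral_clm_apply_le {θ : α → H →L[ℝ] H} (hθ : Integrable θ μ) (u : Lp H ∞ μ) :
    ‖∫ y, θ y (u y) ∂μ‖ ≤ (∫ y, ‖θ y‖ ∂μ) * ‖u‖ := by
  rw [← integral_mul_const]
  refine norm_integral_le_of_norm_le (hθ.norm.mul_const ‖u‖) ?_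
  filter_upwards [ae_norm_le_norm_Linfty u] with y hy
  exact (θ y).le_opNorm_of_le hy

lemma integral_clm_apply_add {θ : α → H →L[ℝ] H} (hθ : Integrable θ μ) (u v : Lp H ∞ μ) :
    ∫ y, θ y ((u + v : Lp H ∞ μ) y) ∂μ = ∫ y, θ y (u y) ∂μ + ∫ y, θ y (v y) ∂μ := by
  rw [← integral_add (integrable_clm_apply hθ u) (integrable_clm_apply hθ v)]
  refine integral_congr_ae ?_
  filter_upwards [Lp.coeFn_add u v] with y hy
  rw [hy, Pi.add_apply, map_add]

lemma integral_clm_apply_smul (θ : α → H →L[ℝ] H) (t : ℝ) (u : Lp H ∞ μ) :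
    ∫ y, θ y ((t • u : Lp H ∞ μ) y) ∂μ = t • ∫ y, θ y (u y) ∂μ := by
  rw [← integral_smul]
  refine integral_congr_ae ?_
  filter_upwards [Lp.coeFn_smul t u] with y hy
  rw [hy, Pi.smul_apply, map_smul]

lemma exists_functional {θ : α → H →L[ℝ] H} (hθ : Integrable θ μ) :
    ∃ b : Lp H ∞ μ →L[ℝ] H, ∀ u, b u = ∫ y, θ y (u y) ∂μ := by
  let b₀ : Lp H ∞ μ →ₗ[ℝ] H :=
    { toFun := fun u => ∫ y, θ y (u y) ∂μ
      map_add' := integral_clm_apply_add hθ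
      map_smul' := integral_clm_apply_smul θ }
  exact ⟨b₀.mkContinuous _ (norm_integral_clm_apply_le hθ), fun u => rfl⟩

lemma exists_kernelOp [SFinite μ] {Θ : α → α → H →L[ℝ] H}
    (hm : AEStronglyMeasurable (fun q : α × α => Θ q.1 q.2) (μ.prod μ)) {M : ℝ} (hM : 0 ≤ M)
    (hi : ∀ᵐ x ∂μ, Integrable (Θ x) μ) (hb : ∀ᵐ x ∂μ, ∫ y, ‖Θ x y‖ ∂μ ≤ M) :
    ∃ K : Lp H ∞ μ →L[ℝ] Lp H ∞ μ, ‖K‖ ≤ M ∧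
      ∀ u, K u =ᵐ[μ] fun x => ∫ y, Θ x y (u y) ∂μ := by
  refine exists_continuousLinearMap_Linfty (fun u x => ∫ y, Θ x y (u y) ∂μ) hM (fun u => ?_)
    (fun u => ?_) (fun u v => ?_) (fun t u => ?_)
  · exact (aestronglyMeasurable_clm_apply hm
      (Lp.aestronglyMeasurable u).comp_snd).integral_prod_right'
  · filter_upwards [hi, hb] with x h1 h2
    exact (norm_integral_clm_apply_le h1 u).trans (by gcongr)
  · filter_upwards [hi] with x h1
    exact integral_clm_apply_add h1 u v
  · filter_upwards [hi] with x h1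
    exact integral_clm_apply_smul (Θ x) t u

/-- A kernel operator on `L^∞` whose kernels `Θ x` are covered, up to `η` in `L¹`, by finitely many
functions is within `η` of a finite rank operator. -/
lemma exists_finiteRank_approx [IsFiniteMeasure μ] [FiniteDimensional ℝ H] {ι : Type*}
    {Θ : α → α → H →L[ℝ] H} (hi : ∀ᵐ x ∂μ, Integrable (Θ x) μ)
    {K : Lp H ∞ μ →L[ℝ] Lp H ∞ μ} (hK : ∀ u, K u =ᵐ[μ] fun x => ∫ y, Θ x y (u y) ∂μ)
    (t : Finset ι) {θ : ι → α → H →L[ℝ] H} (hθ : ∀ j ∈ t, Integrable (θ j) μ)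
    {C : ι → Set α} (hC : ∀ j ∈ t, NullMeasurableSet (C j) μ)
    (hcover : ∀ᵐ x ∂μ, ∃ j ∈ t, x ∈ C j) {η : ℝ} (hη : 0 ≤ η)
    (hclose : ∀ᵐ x ∂μ, ∀ j ∈ t, x ∈ C j → ∫ y, ‖Θ x y - θ j y‖ ∂μ ≤ η) :
    ∃ F : Lp H ∞ μ →L[ℝ] Lp H ∞ μ, FiniteDimensional ℝ (LinearMap.range F.toLinearMap) ∧
      ‖K - F‖ ≤ η := by
  classical
  let χ : ι → α → ℝ := fun j => (C j).indicator fun _ => 1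
  -- A measurable partition of unity: indicators divided by their sum. Uncovered points form a null
  -- set, where the quotient is `0`. The approximating operator sends `u` to `∑ l j * ∫ θ j u`.
  let l : ι → α → ℝ := fun j x => χ j x / ∑ i ∈ t, χ i x
  have hχ0 j x : 0 ≤ χ j x := Set.indicator_nonneg (fun _ _ => zero_le_one) x
  have hχm : ∀ j ∈ t, AEMeasurable (χ j) μ := fun j hj => aemeasurable_const.indicator₀ (hC j hj)
  have hlm : ∀ j ∈ t, AEMeasurable (l j) μ := fun j hj =>
    (hχm j hj).div (Finset.aemeasurable_fun_sum t fun i hi => hχm i hi)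
  have hl0 j x : 0 ≤ l j x := div_nonneg (hχ0 j x) (Finset.sum_nonneg fun i _ => hχ0 i x)
  have hl1 : ∀ j ∈ t, ∀ x, l j x ≤ 1 := fun j hj x =>
    div_le_one_of_le₀ (Finset.single_le_sum (fun i _ => hχ0 i x) hj)
      (Finset.sum_nonneg fun i _ => hχ0 i x)
  have hlsum : ∀ᵐ x ∂μ, ∑ j ∈ t, l j x = 1 := by
    filter_upwards [hcover] with x hx
    obtain ⟨j, hj, hxj⟩ := hx
    rw [← Finset.sum_div]
    refine div_self (ne_of_gt ?_)
    refine lt_of_lt_of_le ?_ (Finset.single_le_sum (fun i _ => hχ0 i x) hj)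
    simp [χ, hxj]
  have hlC j x (hx : x ∉ C j) : l j x = 0 := by simp [l, χ, hx]
  have hop : ∀ j : t, ∃ T : Lp H ∞ μ →L[ℝ] Lp H ∞ μ,
      ∀ u, T u =ᵐ[μ] fun x => l j x • u x := by
    intro j
    obtain ⟨T, -, hT⟩ := exists_mulOp (μ := μ) (H := H)
      (a := fun x => l j x • ContinuousLinearMap.id ℝ H)
      ((hlm j j.2).aestronglyMeasurable.smul_const _) zero_le_one
      (Filter.Eventually.of_forall fun x v => by
        change ‖l j x • v‖ ≤ 1 * ‖v‖
        rw [norm_smul, Real.norm_of_nonneg (hl0 j x)]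
        gcongr
        exact hl1 j j.2 x)
    exact ⟨T, hT⟩
  choose Mop hMop using hop
  have hfun : ∀ j : t, ∃ b : Lp H ∞ μ →L[ℝ] H, ∀ u, b u = ∫ y, θ j y (u y) ∂μ := fun j =>
    exists_functional (hθ j j.2)
  choose b hb using hfun
  let R : t → Lp H ∞ μ →L[ℝ] Lp H ∞ μ := fun j => (Mop j) ∘L (Lp.constL ∞ μ ℝ) ∘L (b j)
  have hR j u : R j u =ᵐ[μ] fun x => l j x • b j u := by
    filter_upwards [hMop j (Lp.constL ∞ μ ℝ (b j u)), Lp.coeFn_const μ (p := ∞) (b j u)]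
      with x h1 h2
    change (Mop j (Lp.constL ∞ μ ℝ (b j u))) x = _
    rw [h1]
    exact congrArg (fun v => l j x • v) h2
  refine ⟨∑ j, R j, ?_, ?_⟩
  · have : (∑ j, R j).toLinearMap = ∑ j, (R j).toLinearMap := by
      ext1 u
      simp
    rw [this]
    refine finiteDimensional_range_sum _ _ fun j _ => ?_
    have h1 : LinearMap.range (R j).toLinearMap ≤
        LinearMap.range ((Mop j) ∘L (Lp.constL ∞ μ ℝ : H →L[ℝ] Lp H ∞ μ)).toLinearMap := by
      rintro _ ⟨u, rfl⟩
      exact ⟨b j u, rfl⟩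
    exact Submodule.finiteDimensional_of_le h1
  · refine ContinuousLinearMap.opNorm_le_bound _ hη fun u => ?_
    refine norm_Linfty_le_of_ae_le (by positivity) ?_
    have hsum : ((∑ j, R j) u : Lp H ∞ μ) =ᵐ[μ] fun x => ∑ j : t, l j x • b j u := by
      have h1 : (∑ j, R j) u = ∑ j, R j u := by simp
      rw [h1]
      filter_upwards [Lp.coeFn_fun_finsetSum Finset.univ (fun j => R j u),
        ae_all_iff.2 fun j => hR j u] with x h2 h3
      rw [h2]
      exact Finset.sum_congr rfl fun j _ => h3 j
    filter_upwards [Lp.coeFn_sub (K u) ((∑ j, R j) u), hK u, hsum, hi, hlsum, hclose]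
      with x h1 h2 h3 h4 h5 h6
    change ‖(K u - (∑ j, R j) u : Lp H ∞ μ) x‖ ≤ _
    rw [h1, Pi.sub_apply, h2, h3]
    -- As the weights sum to `1`, the error is an average of the errors for individual `j`, and only
    -- those `j` with `x ∈ C j` contribute.
    have h7 : ∫ y, Θ x y (u y) ∂μ - ∑ j : t, l j x • b j u =
        ∑ j : t, l j x • ∫ y, (Θ x y - θ j y) (u y) ∂μ := by
      have e1 (j : t) : ∫ y, (Θ x y - θ j y) (u y) ∂μ = ∫ y, Θ x y (u y) ∂μ - b j u := by
        rw [hb, ← integral_sub (integrable_clm_apply h4 u) (integrable_clm_apply (hθ j j.2) u)]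
        rfl
      simp only [e1, smul_sub, Finset.sum_sub_distrib, ← Finset.sum_smul]
      rw [Finset.sum_coe_sort t (fun j => l j x), h5, one_smul]
    rw [h7]
    calc _ ≤ ∑ j : t, l j x * (η * ‖u‖) := by
          refine norm_sum_le_of_le _ fun j _ => ?_
          rw [norm_smul, Real.norm_of_nonneg (hl0 j x)]
          by_cases hx : x ∈ C j
          · refine mul_le_mul_of_nonneg_left ?_ (hl0 j x)
            refine (norm_integral_clm_apply_le (h4.sub (hθ j j.2)) u).trans ?_
            gcongr
            exact h6 j j.2 hx
          · rw [hlC j x hx, zero_mul, zero_mul]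
      _ = η * ‖u‖ := by
          rw [← Finset.sum_mul, Finset.sum_coe_sort t (fun j => l j x), h5, one_mul]

end Operators

/-! ### The linearized force as invertible operator plus finite rank. -/

section Linearization

variable {d : ℕ} {ε : ℝ} {J : ℝ → ℝ} {Ω : Set (E d)}

/-- The micromodulus at the bond from `q.1` to `y`, where the displacement at `q.1` is `q.2`. -/
def bondKernel (ε : ℝ) (J h : ℝ → ℝ) (u : E d → E d) (q : E d × E d) (y : E d) :
    E d →L[ℝ] E d :=
  (kern ε J (y - q.1) * h (stretch (y - q.1) (u y - q.2))) • dyad (dir (y - q.1))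

lemma integrable_bondKernel (hd : 2 ≤ d) (hε : 0 < ε) (hJ : IsInfluenceFunction J)
    {h : ℝ → ℝ} (hh : Measurable h) {C : ℝ} (hC : ∀ r, |h r| ≤ C)
    {u : E d → E d} (hu : AEStronglyMeasurable u (volume.restrict Ω)) (q : E d × E d) :
    Integrable (bondKernel ε J h u q) (volume.restrict Ω) :=
  integrable_smul_dyad (integrable_kern_mul_stretch hd hε hJ hh hC hu q.1 q.2) q.1

lemma norm_bondKernel_le (hε : 0 < ε) (hJ : IsInfluenceFunction J) {h : ℝ → ℝ} {C : ℝ}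
    (hC : ∀ r, |h r| ≤ C) (u : E d → E d) (q : E d × E d) (y : E d) :
    ‖bondKernel ε J h u q y‖ ≤ C * kern ε J (y - q.1) := by
  have hk := kern_nonneg hε hJ (y - q.1)
  have hC0 : 0 ≤ C := (abs_nonneg _).trans (hC 0)
  rw [bondKernel, norm_smul, norm_mul, Real.norm_of_nonneg hk, Real.norm_eq_abs]
  calc _ ≤ kern ε J (y - q.1) * C * 1 := by
        gcongr
        exacts [hC _, norm_dyad_dir_le _]
    _ = _ := by ring

lemma integral_norm_bondKernel_le (hd : 2 ≤ d) (hε : 0 < ε) (hJ : IsInfluenceFunction J)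
    {h : ℝ → ℝ} (hh : Measurable h) {C : ℝ} (hC : ∀ r, |h r| ≤ C)
    {u : E d → E d} (hu : AEStronglyMeasurable u (volume.restrict Ω)) (q : E d × E d) :
    ∫ y in Ω, ‖bondKernel ε J h u q y‖ ≤ C * ∫ z : E d, kern ε J z := by
  have hC0 : 0 ≤ C := (abs_nonneg _).trans (hC 0)
  calc _ ≤ ∫ y in Ω, C * kern ε J (y - q.1) :=
        integral_mono (integrable_bondKernel hd hε hJ hh hC hu q).norm
          ((integrable_kern_sub hd hε hJ q.1 Ω).const_mul C)
          (fun y => norm_bondKernel_le hε hJ hC u q y)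
    _ ≤ ∫ y, C * kern ε J (y - q.1) :=
        setIntegral_le_integral (((integrable_kern hd hε hJ).comp_sub_right q.1).const_mul C)
          (Filter.Eventually.of_forall fun y => mul_nonneg hC0 (kern_nonneg hε hJ _))
    _ = _ := by
        rw [integral_const_mul, integral_sub_right_eq_self]

lemma aestronglyMeasurable_bondKernel [SFinite (volume.restrict Ω)] (hJ : IsInfluenceFunction J)
    {h : ℝ → ℝ} (hh : Measurable h) {u : E d → E d}
    (hu : AEStronglyMeasurable u (volume.restrict Ω)) :
    AEStronglyMeasurable (fun q : E d × E d => bondKernel ε J h u (q.1, u q.1) q.2)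
      ((volume.restrict Ω).prod (volume.restrict Ω)) := by
  have hdir : Measurable fun q : E d × E d => dir (q.2 - q.1) := measurable_dir.comp (by fun_prop)
  exact (aemeasurable_bond_weight hJ hh hu).aestronglyMeasurable.smul
    (continuous_dyad.comp_aestronglyMeasurable hdir.aestronglyMeasurable)

/-- The micromodulus depends continuously in `L¹` on the base point and its displacement. -/
lemma tendsto_integral_norm_bondKernel_sub (hd : 2 ≤ d) (hε : 0 < ε)
    (hJ : IsInfluenceFunction J) {h : ℝ → ℝ} (hh : Continuous h) {C : ℝ} (hC : ∀ r, |h r| ≤ C)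
    {u : E d → E d} (hu : AEStronglyMeasurable u (volume.restrict Ω)) (q₀ : E d × E d) :
    Filter.Tendsto (fun q => ∫ y in Ω, ‖bondKernel ε J h u q y - bondKernel ε J h u q₀ y‖)
      (nhds q₀) (nhds 0) := by
  have hC0 : 0 ≤ C := (abs_nonneg _).trans (hC 0)
  let Φ : E d × E d → E d → E d →L[ℝ] E d := fun q y =>
    h (stretch (y - q.1) (u y - q.2)) • dyad (dir (y - q.1))
  have hΦle q y : ‖Φ q y‖ ≤ C := by
    rw [norm_smul, Real.norm_eq_abs]
    exact (mul_le_of_le_one_right (abs_nonneg _) (norm_dyad_dir_le _)).trans (hC _)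
  have hΦm q : AEStronglyMeasurable (Φ q) (volume.restrict Ω) := by
    refine AEStronglyMeasurable.smul (𝕜 := ℝ) ?_ (aestronglyMeasurable_dyad_dir_sub q.1)
    exact (hh.measurable.comp_aemeasurable (aemeasurable_stretch
      (measurable_id.sub_const q.1).aemeasurable
      (hu.aemeasurable.sub_const q.2))).aestronglyMeasurable
  have hΦc y (hy : y ≠ q₀.1) : ContinuousAt (fun q => Φ q y) q₀ := by
    have hz : y - q₀.1 ≠ 0 := sub_ne_zero.2 hy
    have h1 : ContinuousAt (fun q : E d × E d => (y - q.1, u y - q.2)) q₀ := by fun_prop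
    have h2 : ContinuousAt (fun q : E d × E d => stretch (y - q.1) (u y - q.2)) q₀ :=
      ContinuousAt.comp (f := fun q : E d × E d => (y - q.1, u y - q.2)) (x := q₀)
        (g := fun q : E d × E d => stretch q.1 q.2) (continuousAt_stretch hz) h1
    have h3 : ContinuousAt (fun q : E d × E d => dir (y - q.1)) q₀ :=
      ContinuousAt.comp (f := fun q : E d × E d => y - q.1) (x := q₀) (g := dir)
        (continuousAt_dir hz) (by fun_prop)
    have h4 : ContinuousAt (fun q : E d × E d => h (stretch (y - q.1) (u y - q.2))) q₀ :=
      ContinuousAt.comp (f := fun q : E d × E d => stretch (y - q.1) (u y - q.2)) (x := q₀)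
        (g := h) hh.continuousAt h2
    have h5 : ContinuousAt (fun q : E d × E d => dyad (dir (y - q.1))) q₀ :=
      ContinuousAt.comp (f := fun q : E d × E d => dir (y - q.1)) (x := q₀) (g := dyad)
        continuous_dyad.continuousAt h3
    exact ContinuousAt.smul h4 h5
  -- The first term tends to `0` by `L¹` continuity of translations, the second by dominated
  -- convergence, since `Φ` is bounded and continuous in `q` away from `y = q₀.1`.
  have hsplit q y : ‖bondKernel ε J h u q y - bondKernel ε J h u q₀ y‖ ≤
      C * ‖kern ε J (y - q.1) - kern ε J (y - q₀.1)‖ +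
        kern ε J (y - q₀.1) * ‖Φ q y - Φ q₀ y‖ := by
    have e1 : bondKernel ε J h u q y - bondKernel ε J h u q₀ y =
        (kern ε J (y - q.1) - kern ε J (y - q₀.1)) • Φ q y +
          kern ε J (y - q₀.1) • (Φ q y - Φ q₀ y) := by
      refine ContinuousLinearMap.ext fun v => ?_
      change (kern ε J (y - q.1) * h (stretch (y - q.1) (u y - q.2))) • dyad (dir (y - q.1)) v -
        (kern ε J (y - q₀.1) * h (stretch (y - q₀.1) (u y - q₀.2))) • dyad (dir (y - q₀.1)) v =
        (kern ε J (y - q.1) - kern ε J (y - q₀.1)) •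
          h (stretch (y - q.1) (u y - q.2)) • dyad (dir (y - q.1)) v +
        kern ε J (y - q₀.1) • (h (stretch (y - q.1) (u y - q.2)) • dyad (dir (y - q.1)) v -
          h (stretch (y - q₀.1) (u y - q₀.2)) • dyad (dir (y - q₀.1)) v)
      module
    rw [e1]
    refine (norm_add_le _ _).trans (add_le_add ?_ ?_)
    · rw [norm_smul, mul_comm]
      gcongr
      exact hΦle q y
    · rw [norm_smul, Real.norm_of_nonneg (kern_nonneg hε hJ _)]
  have hk := integrable_kern (d := d) hd hε hJ
  have hkq q : Integrable (fun y => ‖kern ε J (y - q) - kern ε J (y - q₀.1)‖) :=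
    ((hk.comp_sub_right q).sub (hk.comp_sub_right q₀.1)).norm
  have hdom : Integrable (fun y => kern ε J (y - q₀.1) * (2 * C)) (volume.restrict Ω) :=
    (integrable_kern_sub hd hε hJ q₀.1 Ω).mul_const _
  have hm2 q : AEStronglyMeasurable (fun y => kern ε J (y - q₀.1) * ‖Φ q y - Φ q₀ y‖)
      (volume.restrict Ω) :=
    (integrable_kern_sub hd hε hJ q₀.1 Ω).1.mul ((hΦm q).sub (hΦm q₀)).norm
  have hle2 q y : ‖kern ε J (y - q₀.1) * ‖Φ q y - Φ q₀ y‖‖ ≤ kern ε J (y - q₀.1) * (2 * C) := by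
    have hk0 := kern_nonneg hε hJ (y - q₀.1)
    rw [norm_mul, norm_norm, Real.norm_of_nonneg hk0]
    gcongr
    exact (norm_sub_le _ _).trans (by linarith [hΦle q y, hΦle q₀ y])
  have hi2 q : Integrable (fun y => kern ε J (y - q₀.1) * ‖Φ q y - Φ q₀ y‖)
      (volume.restrict Ω) :=
    hdom.mono' (hm2 q) (Filter.Eventually.of_forall (hle2 q))
  have ht1 : Filter.Tendsto
      (fun q : E d × E d => C * ∫ y, ‖kern ε J (y - q.1) - kern ε J (y - q₀.1)‖)
      (nhds q₀) (nhds 0) := by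
    have := ((tendsto_integral_norm_translate_sub hk q₀.1).comp
      (continuous_fst.tendsto q₀)).const_mul C
    simpa using this
  have ht2 : Filter.Tendsto
      (fun q : E d × E d => ∫ y in Ω, kern ε J (y - q₀.1) * ‖Φ q y - Φ q₀ y‖)
      (nhds q₀) (nhds 0) := by
    have h0 : ∫ y in Ω, (fun _ : E d => (0 : ℝ)) y = 0 := by simp
    rw [← h0]
    refine tendsto_integral_filter_of_dominated_convergence
      (fun y => kern ε J (y - q₀.1) * (2 * C)) (Filter.Eventually.of_forall hm2)
      (Filter.Eventually.of_forall fun q => Filter.Eventually.of_forall (hle2 q)) hdom ?_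
    filter_upwards [Filter.Eventually.of_forall fun y => trivial] with y _
    -- At the singular bond the weight is `0`, by division by zero in `kern`.
    by_cases hy : y = q₀.1
    · have : kern ε J (0 : E d) = 0 := by simp [kern]
      simp [hy, this]
    · have h1 : Filter.Tendsto (fun q => Φ q y - Φ q₀ y) (nhds q₀) (nhds (Φ q₀ y - Φ q₀ y)) :=
        (hΦc y hy).tendsto.sub_const _
      have h2 := h1.norm.const_mul (kern ε J (y - q₀.1))
      simpa using h2
  have ht := ht1.add ht2
  rw [add_zero] at ht
  refine squeeze_zero (fun q => integral_nonneg fun y => norm_nonneg _) (fun q => ?_) ht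
  calc _ ≤ ∫ y in Ω, (C * ‖kern ε J (y - q.1) - kern ε J (y - q₀.1)‖ +
        kern ε J (y - q₀.1) * ‖Φ q y - Φ q₀ y‖) :=
        integral_mono ((integrable_bondKernel hd hε hJ hh.measurable hC hu q).sub
          (integrable_bondKernel hd hε hJ hh.measurable hC hu q₀)).norm
          (((hkq q.1).restrict.const_mul C).add (hi2 q)) (hsplit q)
    _ = C * (∫ y in Ω, ‖kern ε J (y - q.1) - kern ε J (y - q₀.1)‖) +
        ∫ y in Ω, kern ε J (y - q₀.1) * ‖Φ q y - Φ q₀ y‖ := by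
        rw [integral_add ((hkq q.1).restrict.const_mul C) (hi2 q), integral_const_mul]
    _ ≤ _ := by
        refine add_le_add (mul_le_mul_of_nonneg_left ?_ hC0) le_rfl
        exact setIntegral_le_integral (hkq q.1)
          (Filter.Eventually.of_forall fun y => norm_nonneg _)

/-- Since `u` is merely bounded, `x ↦ Θ x` need not be continuous in `L¹`. Freezing the displacement
as a separate variable restores continuity, and `(x, u x)` a.e. stays in a compact set, covered by
finitely many `η`-neighbourhoods. -/
lemma exists_finiteRank_approx_bondKernel (hd : 2 ≤ d) (hΩ : MeasurableSet Ω)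
    (hb : Bornology.IsBounded Ω)
    [IsFiniteMeasure (volume.restrict Ω)] (hε : 0 < ε) (hJ : IsInfluenceFunction J) {h : ℝ → ℝ}
    (hh : Continuous h) {C : ℝ} (hC : ∀ r, |h r| ≤ C) {u : E d → E d}
    (hu : MemLp u ∞ (volume.restrict Ω))
    {K : Lp (E d) ∞ (volume.restrict Ω) →L[ℝ] Lp (E d) ∞ (volume.restrict Ω)}
    (hK : ∀ w, K w =ᵐ[volume.restrict Ω] fun x =>
      ∫ y in Ω, bondKernel ε J h u (x, u x) y (w y)) {η : ℝ} (hη : 0 < η) :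
    ∃ F : Lp (E d) ∞ (volume.restrict Ω) →L[ℝ] Lp (E d) ∞ (volume.restrict Ω),
      FiniteDimensional ℝ (LinearMap.range F.toLinearMap) ∧ ‖K - F‖ ≤ η := by
  set μ := volume.restrict Ω with hμ
  set D : E d × E d → E d × E d → ℝ := fun q q' =>
    ∫ y in Ω, ‖bondKernel ε J h u q' y - bondKernel ε J h u q y‖ with hD
  set N := ‖hu.toLp u‖ with hN
  have hcpt : IsCompact (closure Ω ×ˢ Metric.closedBall (0 : E d) N) :=
    hb.isCompact_closure.prod (isCompact_closedBall _ _)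
  -- Interiors are taken so that the preimages under `x ↦ (x, u x)` are measurable.
  obtain ⟨t, -, ht⟩ := hcpt.elim_nhds_subcover (fun q => interior {q' | D q q' < η})
    (fun q _ => interior_mem_nhds.2 ((tendsto_integral_norm_bondKernel_sub hd hε hJ hh hC hu.1
      q).eventually (gt_mem_nhds hη)))
  have hi x : Integrable (bondKernel ε J h u (x, u x)) μ :=
    integrable_bondKernel hd hε hJ hh.measurable hC hu.1 _
  refine exists_finiteRank_approx (Θ := fun x => bondKernel ε J h u (x, u x))
    (θ := fun q => bondKernel ε J h u q)
    (C := fun q => {x | (x, u x) ∈ interior {q' | D q q' < η}})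
    (Filter.Eventually.of_forall hi) hK t
    (fun q _ => integrable_bondKernel hd hε hJ hh.measurable hC hu.1 q) ?_ ?_ hη.le ?_
  · intro q _
    exact (aemeasurable_id.prodMk hu.1.aemeasurable).nullMeasurableSet_preimage
      isOpen_interior.measurableSet
  · filter_upwards [ae_restrict_mem hΩ, ae_norm_le_norm_Linfty (hu.toLp u), hu.coeFn_toLp]
      with x hx h1 h2
    have : (x, u x) ∈ closure Ω ×ˢ Metric.closedBall (0 : E d) N :=
      ⟨subset_closure hx, by rw [mem_closedBall_zero_iff, ← h2]; exact h1⟩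
    obtain ⟨q, hq, hxq⟩ := Set.mem_iUnion₂.1 (ht this)
    exact ⟨q, hq, hxq⟩
  · refine Filter.Eventually.of_forall fun x q _ hx => ?_
    have h1 : (x, u x) ∈ {q' | D q q' < η} := interior_subset hx
    exact le_of_lt h1

lemma stabilityTensor_eq_integral_bondKernel (g : ℝ → ℝ) (u : E d → E d) (x : E d) :
    stabilityTensor Ω ε J g u x =
      ∫ y in Ω, bondKernel ε J (iteratedDeriv 2 g) u (x, u x) y :=
  stabilityTensor_eq Ω g u x

lemma inner_stabilityTensor_symm (hd : 2 ≤ d) (hε : 0 < ε) (hJ : IsInfluenceFunction J)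
    {g : ℝ → ℝ} (hh : Measurable (iteratedDeriv 2 g)) {C : ℝ}
    (hC : ∀ r, |iteratedDeriv 2 g r| ≤ C) {u : E d → E d}
    (hu : AEStronglyMeasurable u (volume.restrict Ω)) (x v w : E d) :
    inner ℝ (stabilityTensor Ω ε J g u x v) w = inner ℝ v (stabilityTensor Ω ε J g u x w) := by
  have hwi := integrable_kern_mul_stretch (Ω := Ω) hd hε hJ hh hC hu x (u x)
  rw [real_inner_comm _ v, stabilityTensor_eq, inner_integral_smul_dyad hwi,
    inner_integral_smul_dyad hwi]
  refine integral_congr_ae (Filter.Eventually.of_forall fun y => ?_)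
  simp only [inner_dyad_symm _ v w, real_inner_comm v]

lemma forceDeriv_eq_stabilityTensor_sub (hd : 2 ≤ d) (hε : 0 < ε) (hJ : IsInfluenceFunction J)
    {g : ℝ → ℝ} (hh : Measurable (iteratedDeriv 2 g)) {C : ℝ}
    (hC : ∀ r, |iteratedDeriv 2 g r| ≤ C) {u : E d → E d}
    (hu : AEStronglyMeasurable u (volume.restrict Ω)) (w : Lp (E d) ∞ (volume.restrict Ω))
    (x : E d) :
    forceDeriv Ω ε J g u w x = (2 : ℝ) • (stabilityTensor Ω ε J g u x (w x) -
      ∫ y in Ω, bondKernel ε J (iteratedDeriv 2 g) u (x, u x) y (w y)) := by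
  have hi := integrable_bondKernel hd hε hJ hh hC hu (x, u x)
  rw [forceDeriv_eq, stabilityTensor_eq_integral_bondKernel,
    ContinuousLinearMap.integral_apply hi, ← neg_sub, smul_neg,
    ← integral_sub (integrable_clm_apply hi w) (hi.apply_continuousLinearMap (w x)),
    ← integral_smul]
  refine congrArg Neg.neg (integral_congr_ae (Filter.Eventually.of_forall fun y => ?_))
  change _ = (2 : ℝ) • (bondKernel ε J (iteratedDeriv 2 g) u (x, u x) y (w y) -
    bondKernel ε J (iteratedDeriv 2 g) u (x, u x) y (w x))
  rw [← map_sub]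
  exact mul_smul (2 : ℝ) _ _

/-- The gap `γ / M` of `T₁` absorbs `M⁻¹ • (K - F)`, of norm at most half of it, so a Neumann series
inverts `B`; what remains of `K` is `F' = 2 F`. -/
lemma exists_bijective_sub_finiteRank {X : Type*} [NormedAddCommGroup X] [NormedSpace ℝ X]
    [CompleteSpace X] {T₁ K F : X →L[ℝ] X} {M γ : ℝ} (hM : 0 < M) (hγ : 0 < γ)
    (hT₁ : ‖T₁‖ ≤ 1 - γ / M) (hKF : ‖K - F‖ ≤ γ / 2)
    (hF : FiniteDimensional ℝ (LinearMap.range F.toLinearMap)) :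
    ∃ B F' : X →L[ℝ] X, (2 * M) • (1 - (T₁ + M⁻¹ • K)) = B - F' ∧ Function.Bijective B ∧
      FiniteDimensional ℝ (LinearMap.range F'.toLinearMap) := by
  have hunit : IsUnit (1 - (T₁ + M⁻¹ • (K - F))) := by
    refine isUnit_one_sub_of_norm_lt_one ?_
    have h1 : ‖M⁻¹ • (K - F)‖ ≤ M⁻¹ * (γ / 2) := by
      rw [norm_smul, Real.norm_of_nonneg (inv_nonneg.2 hM.le)]
      gcongr
    have h2 : 0 < M⁻¹ * (γ / 2) := by positivity
    have h3 : γ / M = 2 * (M⁻¹ * (γ / 2)) := by rw [div_eq_mul_inv]; ring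
    calc _ ≤ ‖T₁‖ + ‖M⁻¹ • (K - F)‖ := norm_add_le _ _
      _ < 1 := by linarith
  refine ⟨(2 * M) • (1 - (T₁ + M⁻¹ • (K - F))), (2 : ℝ) • F, ?_, ?_, ?_⟩
  · have h : (2 : ℝ) = 2 * M * M⁻¹ := by rw [mul_assoc, mul_inv_cancel₀ hM.ne', mul_one]
    nth_rewrite 3 [h]
    module
  · have h2 : (2 * M) ≠ 0 := by positivity
    obtain ⟨U, hU⟩ := hunit.smul (Units.mk0 (2 * M) h2)
    have hU' : (U : X →L[ℝ] X) = (2 * M) • (1 - (T₁ + M⁻¹ • (K - F))) := hU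
    rw [← hU']
    exact (ContinuousLinearEquiv.ofUnit U).bijective
  · exact finiteDimensional_range_smul hF 2

set_option maxHeartbeats 800000 in
/-- The linearized force on `L^∞` is a finite rank perturbation of an invertible operator. -/
theorem exists_linearizedForce (hd : 2 ≤ d) (hΩ : IsOpen Ω) (hb : Bornology.IsBounded Ω)
    [IsFiniteMeasure (volume.restrict Ω)]
    (hcone : InteriorConeCondition Ω) (hε : 0 < ε) (hJ : IsInfluenceFunction J)
    {g : ℝ → ℝ} {re rc : ℝ} (hg : IsCohesivePotential g re rc) {u : E d → E d}
    (hu : MemLp u ∞ (volume.restrict Ω)) (huS : StrictlyInsideStrengthDomain Ω ε re rc u) :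
    ∃ T B F : Lp (E d) ∞ (volume.restrict Ω) →L[ℝ] Lp (E d) ∞ (volume.restrict Ω),
      (∀ w, T w =ᵐ[volume.restrict Ω] forceDeriv Ω ε J g u w) ∧ T = B - F ∧
      Function.Bijective B ∧ FiniteDimensional ℝ (LinearMap.range F.toLinearMap) := by
  set μ := volume.restrict Ω with hμ
  obtain ⟨γ, hγ, hcoer⟩ := exists_pos_lt_inner_stabilityTensor hd hΩ hcone hε hJ hg hu.1 huS
  obtain ⟨C, hC⟩ := hg.bounded 2 (by norm_num)
  have hC0 : 0 ≤ C := (abs_nonneg _).trans (hC 0)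
  have hh : Continuous (iteratedDeriv 2 g) := (hg.differentiable 2 (by norm_num)).continuous
  set h := iteratedDeriv 2 g with hhdef
  set Θ : E d → E d → E d →L[ℝ] E d := fun x => bondKernel ε J h u (x, u x) with hΘ
  set A : E d → E d →L[ℝ] E d := fun x => stabilityTensor Ω ε J g u x with hA
  have hAΘ x : A x = ∫ y in Ω, Θ x y := stabilityTensor_eq_integral_bondKernel g u x
  have hΘi x : Integrable (Θ x) μ := integrable_bondKernel hd hε hJ hh.measurable hC hu.1 _
  have hΘm : AEStronglyMeasurable (fun q : E d × E d => Θ q.1 q.2) (μ.prod μ) :=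
    aestronglyMeasurable_bondKernel hJ hh.measurable hu.1
  set I := C * ∫ z : E d, kern ε J z with hI
  have hI0 : 0 ≤ I := mul_nonneg hC0 (integral_nonneg fun z => kern_nonneg hε hJ z)
  have hΘb x : ∫ y, ‖Θ x y‖ ∂μ ≤ I :=
    integral_norm_bondKernel_le hd hε hJ hh.measurable hC hu.1 _
  obtain ⟨K, -, hK⟩ := exists_kernelOp hΘm hI0 (Filter.Eventually.of_forall hΘi)
    (Filter.Eventually.of_forall hΘb)
  obtain ⟨F, hFfin, hF⟩ := exists_finiteRank_approx_bondKernel hd hΩ.measurableSet hb hε hJ hh hC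
    hu hK (half_pos hγ)
  have hAm : AEStronglyMeasurable A μ := by
    have : A = fun x => ∫ y in Ω, Θ x y := funext hAΘ
    rw [this]
    exact hΘm.integral_prod_right'
  have hAsymm x v w : inner ℝ (A x v) w = inner ℝ v (A x w) :=
    inner_stabilityTensor_symm hd hε hJ hh.measurable hC hu.1 x v w
  have hAle x v : ‖A x v‖ ≤ I * ‖v‖ := by
    refine (A x).le_of_opNorm_le ?_ v
    rw [hAΘ]
    exact (norm_integral_le_integral_norm _).trans (hΘb x)
  -- `M` must bound `𝔸` from above and satisfy `M ≥ γ`, so that `1 - γ / M` is a legitimate norm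
  -- bound; the summand `γ` also makes `M` positive.
  set M := γ + I with hM
  have hM0 : 0 < M := by positivity
  have hAin x v : inner ℝ (A x v) v ≤ M * ‖v‖ ^ 2 := by
    have h1 := real_inner_le_norm (A x v) v
    have h2 := hAle x v
    have h3 : ‖A x v‖ * ‖v‖ ≤ I * ‖v‖ * ‖v‖ := by gcongr
    have h4 : 0 ≤ γ * ‖v‖ ^ 2 := by positivity
    rw [hM]
    nlinarith
  have hγM : γ / M ≤ 1 := (div_le_one hM0).2 (by linarith)
  -- The bounds `γ ≤ 𝔸(x) ≤ M` place the symmetric operator `1 - M⁻¹ 𝔸(x)` between `0` and `1 - γ /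
  -- M`.
  have hmul : ∀ᵐ x ∂μ, ∀ v, ‖(ContinuousLinearMap.id ℝ (E d) - M⁻¹ • A x) v‖ ≤
      (1 - γ / M) * ‖v‖ := by
    filter_upwards [ae_restrict_mem hΩ.measurableSet] with x hx
    have hin v w : inner ℝ ((ContinuousLinearMap.id ℝ (E d) - M⁻¹ • A x) v) w =
        inner ℝ v w - M⁻¹ * inner ℝ (A x v) w := by
      change inner ℝ (v - M⁻¹ • A x v) w = _
      rw [inner_sub_left, real_inner_smul_left]
    refine norm_apply_le_of_quadraticForm_le _ (fun v w => ?_) (by linarith) (fun v => ?_)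
      (fun v => ?_)
    · rw [real_inner_comm ((ContinuousLinearMap.id ℝ (E d) - M⁻¹ • A x) w) v, hin, hin, hAsymm,
        real_inner_comm w v, real_inner_comm (A x w) v]
    · rw [hin, real_inner_self_eq_norm_sq, sub_nonneg, inv_mul_le_iff₀ hM0]
      exact hAin x v
    · rw [hin, real_inner_self_eq_norm_sq]
      have h1 : γ * ‖v‖ ^ 2 ≤ inner ℝ (A x v) v := by
        by_cases hv : v = 0
        · simp [hv]
        · exact (hcoer x hx v hv).le
      have h2 : M⁻¹ * (γ * ‖v‖ ^ 2) ≤ M⁻¹ * inner ℝ (A x v) v := by gcongr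
      have h3 : (1 - γ / M) * ‖v‖ ^ 2 = ‖v‖ ^ 2 - M⁻¹ * (γ * ‖v‖ ^ 2) := by
        rw [div_eq_mul_inv]
        ring
      linarith
  obtain ⟨T₁, hT₁n, hT₁⟩ := exists_mulOp (μ := μ)
    (a := fun x => ContinuousLinearMap.id ℝ (E d) - M⁻¹ • A x)
    (aestronglyMeasurable_const.sub (hAm.const_smul M⁻¹)) (sub_nonneg.2 hγM) hmul
  obtain ⟨B, F', hBF, hB, hF'⟩ := exists_bijective_sub_finiteRank hM0 hγ hT₁n hF hFfin
  refine ⟨(2 * M) • (1 - (T₁ + M⁻¹ • K)), B, F', fun w => ?_, hBF, hB, hF'⟩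
  have e1 : ((2 * M) • (1 - (T₁ + M⁻¹ • K))) w = (2 * M) • (w - (T₁ w + M⁻¹ • K w)) := rfl
  rw [e1]
  filter_upwards [Lp.coeFn_smul (2 * M) (w - (T₁ w + M⁻¹ • K w)),
    Lp.coeFn_sub w (T₁ w + M⁻¹ • K w), Lp.coeFn_add (T₁ w) (M⁻¹ • K w),
    Lp.coeFn_smul M⁻¹ (K w), hT₁ w, hK w] with x h1 h2 h3 h4 h5 h6
  rw [h1, Pi.smul_apply, h2, Pi.sub_apply, h3, Pi.add_apply, h4, Pi.smul_apply, h5, h6,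
    forceDeriv_eq_stabilityTensor_sub hd hε hJ hh.measurable hC hu.1]
  change (2 * M) • (w x - (w x - M⁻¹ • A x (w x) + M⁻¹ • ∫ y, Θ x y (w y) ∂μ)) =
    (2 : ℝ) • (A x (w x) - ∫ y, Θ x y (w y) ∂μ)
  have e3 : w x - (w x - M⁻¹ • A x (w x) + M⁻¹ • ∫ y, Θ x y (w y) ∂μ) =
      M⁻¹ • (A x (w x) - ∫ y, Θ x y (w y) ∂μ) := by
    rw [smul_sub]
    abel
  rw [e3, smul_smul, mul_assoc, mul_inv_cancel₀ hM0.ne', mul_one]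

end Linearization

/-! ### The space `𝒱` as orthogonal complement of the rigid motions, and inversion on it. -/

section OrthogonalComplement

variable {d : ℕ} {ε : ℝ} {J : ℝ → ℝ} {Ω : Set (E d)}

section Pairing

variable {α H : Type*} [MeasurableSpace α] {μ : Measure α} [IsFiniteMeasure μ]
  [NormedAddCommGroup H] [InnerProductSpace ℝ H]

lemma integrable_inner_Linfty (u v : Lp H ∞ μ) :
    Integrable (fun x => (inner ℝ (u x) (v x) : ℝ)) μ := by
  refine (integrable_const (‖u‖ * ‖v‖)).mono'
    ((Lp.aestronglyMeasurable u).inner (Lp.aestronglyMeasurable v)) ?_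
  filter_upwards [ae_norm_le_norm_Linfty u, ae_norm_le_norm_Linfty v] with x h1 h2
  exact (norm_inner_le_norm _ _).trans (by gcongr)

/-- The `L²` pairing on `L^∞`. -/
def pairing (μ : Measure α) [IsFiniteMeasure μ] : Lp H ∞ μ →ₗ[ℝ] Lp H ∞ μ →ₗ[ℝ] ℝ :=
  LinearMap.mk₂ ℝ (fun u v => ∫ x, (inner ℝ (u x) (v x) : ℝ) ∂μ)
    (fun u u' v => by
      rw [← integral_add (integrable_inner_Linfty u v) (integrable_inner_Linfty u' v)]
      refine integral_congr_ae ?_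
      filter_upwards [Lp.coeFn_add u u'] with x hx
      rw [hx, Pi.add_apply, inner_add_left])
    (fun c u v => by
      rw [smul_eq_mul, ← integral_const_mul]
      refine integral_congr_ae ?_
      filter_upwards [Lp.coeFn_smul c u] with x hx
      rw [hx, Pi.smul_apply, real_inner_smul_left])
    (fun u v v' => by
      rw [← integral_add (integrable_inner_Linfty u v) (integrable_inner_Linfty u v')]
      refine integral_congr_ae ?_
      filter_upwards [Lp.coeFn_add v v'] with x hx
      rw [hx, Pi.add_apply, inner_add_right])
    (fun c u v => by
      rw [smul_eq_mul, ← integral_const_mul]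
      refine integral_congr_ae ?_
      filter_upwards [Lp.coeFn_smul c v] with x hx
      rw [hx, Pi.smul_apply, real_inner_smul_right])

lemma pairing_apply (u v : Lp H ∞ μ) :
    pairing μ u v = ∫ x, (inner ℝ (u x) (v x) : ℝ) ∂μ := rfl

lemma continuous_pairing_left (v : Lp H ∞ μ) : Continuous fun u => pairing μ u v := by
  have hb (u : Lp H ∞ μ) : ‖(pairing μ).flip v u‖ ≤ (‖v‖ * μ.real Set.univ) * ‖u‖ := by
    rw [LinearMap.flip_apply, pairing_apply]
    refine (norm_integral_le_of_norm_le_const (C := ‖u‖ * ‖v‖) ?_).trans_eq (by ring)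
    filter_upwards [ae_norm_le_norm_Linfty u, ae_norm_le_norm_Linfty v] with x h1 h2
    exact (norm_inner_le_norm _ _).trans (by gcongr)
  exact (((pairing μ).flip v).mkContinuous _ hb).continuous

lemma eq_zero_of_pairing_self {u : Lp H ∞ μ} (h : pairing μ u u = 0) : u = 0 := by
  rw [pairing_apply, integral_eq_zero_iff_of_nonneg
    (fun x => real_inner_self_nonneg) (integrable_inner_Linfty u u)] at h
  rw [Lp.eq_zero_iff_ae_eq_zero]
  filter_upwards [h] with x hx
  exact inner_self_eq_zero.1 hx

end Pairing

lemma isFiniteMeasure_restrict_of_isBounded (hb : Bornology.IsBounded Ω) :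
    IsFiniteMeasure ((volume : Measure (E d)).restrict Ω) :=
  isFiniteMeasure_restrict.2 hb.measure_lt_top.ne

lemma memLp_top_of_continuous (hΩ : MeasurableSet Ω) (hb : Bornology.IsBounded Ω)
    {f : E d → E d} (hf : Continuous f) : MemLp f ∞ (volume.restrict Ω) := by
  obtain ⟨C, hC⟩ := (hb.isCompact_closure.image hf).isBounded.exists_norm_le
  refine memLp_top_of_ae_le hf.aestronglyMeasurable (C := C) ?_
  filter_upwards [ae_restrict_mem hΩ] with x hx
  exact hC _ ⟨x, subset_closure hx, rfl⟩

/-- Affine maps as elements of `L^∞`. -/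
def affineToLp (hΩ : MeasurableSet Ω) (hb : Bornology.IsBounded Ω) :
    ((E d →L[ℝ] E d) × E d) →ₗ[ℝ] Lp (E d) ∞ (volume.restrict Ω) where
  toFun q := (memLp_top_of_continuous hΩ hb
    (show Continuous fun x => q.1 x + q.2 by fun_prop)).toLp (fun x => q.1 x + q.2)
  map_add' q q' := by
    rw [← MemLp.toLp_add]
    refine (MemLp.toLp_eq_toLp_iff _ _).2 (Filter.Eventually.of_forall fun x => ?_)
    change q.1 x + q'.1 x + (q.2 + q'.2) = (q.1 x + q.2) + (q'.1 x + q'.2)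
    abel
  map_smul' t q := by
    rw [RingHom.id_apply, ← MemLp.toLp_const_smul]
    refine (MemLp.toLp_eq_toLp_iff _ _).2 (Filter.Eventually.of_forall fun x => ?_)
    change t • q.1 x + t • q.2 = t • (q.1 x + q.2)
    rw [smul_add]

lemma affineToLp_ae_eq (hΩ : MeasurableSet Ω) (hb : Bornology.IsBounded Ω)
    (q : (E d →L[ℝ] E d) × E d) :
    affineToLp hΩ hb q =ᵐ[volume.restrict Ω] fun x => q.1 x + q.2 :=
  (memLp_top_of_continuous hΩ hb (show Continuous fun x => q.1 x + q.2 by fun_prop)).coeFn_toLp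

/-- The rigid motions as a subspace of `L^∞`. -/
def rigidSubmodule (hΩ : MeasurableSet Ω) (hb : Bornology.IsBounded Ω) :
    Submodule ℝ (Lp (E d) ∞ (volume.restrict Ω)) :=
  Submodule.map (affineToLp hΩ hb)
    { carrier := {q | ∀ v, inner ℝ (q.1 v) v = 0}
      zero_mem' := fun v => by simp
      add_mem' := fun {q q'} h h' v => by
        change inner ℝ (q.1 v + q'.1 v) v = 0
        rw [inner_add_left, h v, h' v, add_zero]
      smul_mem' := fun t q h v => by
        change inner ℝ (t • q.1 v) v = 0
        rw [real_inner_smul_left, h v, mul_zero] }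

lemma finiteDimensional_rigidSubmodule (hΩ : MeasurableSet Ω) (hb : Bornology.IsBounded Ω) :
    FiniteDimensional ℝ (rigidSubmodule hΩ hb) := by
  unfold rigidSubmodule
  infer_instance

lemma exists_rigidMotion_of_mem_rigidSubmodule (hΩ : MeasurableSet Ω)
    (hb : Bornology.IsBounded Ω) {r : Lp (E d) ∞ (volume.restrict Ω)}
    (hr : r ∈ rigidSubmodule hΩ hb) : ∃ π ∈ rigidMotions d, r =ᵐ[volume.restrict Ω] π := by
  obtain ⟨q, hq, rfl⟩ := hr
  exact ⟨_, mem_rigidMotions_of_skew q.1 hq q.2, affineToLp_ae_eq hΩ hb q⟩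

lemma exists_mem_rigidSubmodule_of_rigidMotion (hΩ : MeasurableSet Ω)
    (hb : Bornology.IsBounded Ω) {π : E d → E d} (hπ : π ∈ rigidMotions d) :
    ∃ r ∈ rigidSubmodule hΩ hb, r =ᵐ[volume.restrict Ω] π := by
  obtain ⟨A, c, hA, h⟩ := exists_skew_of_mem_rigidMotions hπ
  refine ⟨affineToLp hΩ hb (A, c), ⟨(A, c), hA, rfl⟩, ?_⟩
  rw [funext h]
  exact affineToLp_ae_eq hΩ hb (A, c)

lemma mem_V_iff_integral (hΩ : MeasurableSet Ω) (hb : Bornology.IsBounded Ω)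
    {u : Lp (E d) ∞ (volume.restrict Ω)} :
    u ∈ V Ω ↔ ∀ π ∈ rigidMotions d, ∫ x in Ω, inner ℝ (u x) (π x) = 0 := by
  have := isFiniteMeasure_restrict_of_isBounded hb
  refine ⟨fun h π hπ => (h π hπ).2, fun h π hπ => ⟨?_, h π hπ⟩⟩
  obtain ⟨r, -, hr⟩ := exists_mem_rigidSubmodule_of_rigidMotion hΩ hb hπ
  refine (integrable_inner_Linfty u r).congr ?_
  filter_upwards [hr] with x hx
  rw [hx]

lemma mem_V_iff_pairing [IsFiniteMeasure (volume.restrict Ω)] (hΩ : MeasurableSet Ω)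
    (hb : Bornology.IsBounded Ω) {u : Lp (E d) ∞ (volume.restrict Ω)} :
    u ∈ V Ω ↔ ∀ r ∈ rigidSubmodule hΩ hb, pairing (volume.restrict Ω) u r = 0 := by
  rw [mem_V_iff_integral hΩ hb]
  constructor
  · intro h r hr
    obtain ⟨π, hπ, hrπ⟩ := exists_rigidMotion_of_mem_rigidSubmodule hΩ hb hr
    rw [pairing_apply, ← h π hπ]
    refine integral_congr_ae ?_
    filter_upwards [hrπ] with x hx
    rw [hx]
  · intro h π hπ
    obtain ⟨r, hr, hrπ⟩ := exists_mem_rigidSubmodule_of_rigidMotion hΩ hb hπ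
    rw [← h r hr, pairing_apply]
    refine integral_congr_ae ?_
    filter_upwards [hrπ] with x hx
    rw [hx]

lemma isClosed_V (hΩ : MeasurableSet Ω) (hb : Bornology.IsBounded Ω) :
    IsClosed (V Ω : Set (Lp (E d) ∞ (volume.restrict Ω))) := by
  have := isFiniteMeasure_restrict_of_isBounded hb
  have h : (V Ω : Set (Lp (E d) ∞ (volume.restrict Ω))) =
      ⋂ r ∈ rigidSubmodule hΩ hb, {u | pairing (volume.restrict Ω) u r = 0} := by
    ext u
    rw [SetLike.mem_coe, mem_V_iff_pairing hΩ hb]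
    simp
  rw [h]
  exact isClosed_biInter fun r _ => isClosed_eq (continuous_pairing_left r) continuous_const

/-- A finite rank map onto rigid motions with kernel `𝒱`. -/
lemma exists_finiteRank_ker_eq_V (hΩ : MeasurableSet Ω) (hb : Bornology.IsBounded Ω) :
    ∃ P : Lp (E d) ∞ (volume.restrict Ω) →ₗ[ℝ] Lp (E d) ∞ (volume.restrict Ω),
      FiniteDimensional ℝ (LinearMap.range P) ∧ (∀ u, P u ∈ rigidSubmodule hΩ hb) ∧
      ∀ u, P u = 0 → u ∈ V Ω := by
  have := isFiniteMeasure_restrict_of_isBounded hb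
  have := finiteDimensional_rigidSubmodule hΩ hb
  set R := rigidSubmodule hΩ hb
  -- Any isomorphism with the dual serves: only the range and the kernel of the resulting map
  -- matter, so no orthogonal projection is built.
  let e : Module.Dual ℝ R ≃ₗ[ℝ] R := LinearEquiv.ofFinrankEq _ _ Subspace.dual_finrank_eq
  let φ : Lp (E d) ∞ (volume.restrict Ω) →ₗ[ℝ] Module.Dual ℝ R :=
    (pairing (volume.restrict Ω)).compl₂ R.subtype
  refine ⟨R.subtype ∘ₗ e.toLinearMap ∘ₗ φ, ?_, fun u => (e (φ u)).2, fun u hu => ?_⟩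
  · have h : LinearMap.range (R.subtype ∘ₗ e.toLinearMap ∘ₗ φ) ≤ R := by
      rintro _ ⟨u, rfl⟩
      exact (e (φ u)).2
    exact Submodule.finiteDimensional_of_le h
  · have h1 : e (φ u) = 0 := Subtype.ext hu
    have h2 : φ u = 0 := by simpa using h1
    rw [mem_V_iff_pairing hΩ hb]
    intro r hr
    exact LinearMap.congr_fun h2 ⟨r, hr⟩

/-- An operator on `L^∞` with range in `𝒱`, injective on `𝒱`, that is a finite rank perturbation
of an invertible one restricts to an isomorphism of `𝒱`. -/
lemma exists_equiv_V (hΩ : MeasurableSet Ω) (hb : Bornology.IsBounded Ω)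
    {T B F : Lp (E d) ∞ (volume.restrict Ω) →L[ℝ] Lp (E d) ∞ (volume.restrict Ω)}
    (hTBF : T = B - F) (hB : Function.Bijective B)
    (hF : FiniteDimensional ℝ (LinearMap.range F.toLinearMap)) (hTV : ∀ w, T w ∈ V Ω)
    (hinj : ∀ w ∈ V Ω, T w = 0 → w = 0) :
    ∃ T' : V Ω ≃L[ℝ] V Ω, ∀ w, ((T' w : V Ω) : Lp (E d) ∞ (volume.restrict Ω)) = T w := by
  have := isFiniteMeasure_restrict_of_isBounded hb
  obtain ⟨P, hPfin, hPR, hPker⟩ := exists_finiteRank_ker_eq_V hΩ hb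
  have hdisj : ∀ r ∈ V Ω, r ∈ rigidSubmodule hΩ hb → r = 0 := fun r hr hr' =>
    eq_zero_of_pairing_self ((mem_V_iff_pairing hΩ hb).1 hr r hr')
  -- `B - F' = T + P`. If `T w + P w = f` with `f ∈ 𝒱`, then `P w` lies in `𝒱` and is rigid, hence
  -- is `0`, so `w ∈ 𝒱` and `T w = f`. The case `f = 0` gives injectivity, the general case
  -- surjectivity on `𝒱`.
  let F' : Lp (E d) ∞ (volume.restrict Ω) →ₗ[ℝ] Lp (E d) ∞ (volume.restrict Ω) :=
    F.toLinearMap + (-1 : ℝ) • P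
  have hF' : FiniteDimensional ℝ (LinearMap.range F') :=
    finiteDimensional_range_add hF (finiteDimensional_range_smul hPfin _)
  have hdiff w : (B.toLinearMap - F') w = T w + P w := by
    rw [hTBF]
    change B w - (F w + (-1 : ℝ) • P w) = B w - F w + P w
    rw [neg_one_smul]
    abel
  have hinj' : Function.Injective (B.toLinearMap - F') := by
    rw [injective_iff_map_eq_zero]
    intro w hw
    rw [hdiff] at hw
    have hPw : P w = 0 := by
      refine hdisj _ ?_ (hPR w)
      rw [eq_neg_of_add_eq_zero_right hw]
      exact (V Ω).neg_mem (hTV w)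
    rw [hPw, add_zero] at hw
    exact hinj w (hPker w hPw) hw
  have hsurj := surjective_of_injective_sub_finiteRank B.toLinearMap F' hB hF' hinj'
  let TV : V Ω →L[ℝ] V Ω := (T.comp (V Ω).subtypeL).codRestrict (V Ω) fun w => hTV w
  have hTVapp w : ((TV w : V Ω) : Lp (E d) ∞ (volume.restrict Ω)) = T w := rfl
  -- Completeness lets the open mapping theorem supply the bounded inverse.
  have : CompleteSpace (V Ω) := (isClosed_V hΩ hb).completeSpace_coe
  have hker : LinearMap.ker (TV : V Ω →ₗ[ℝ] V Ω) = ⊥ := by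
    rw [LinearMap.ker_eq_bot']
    intro w hw
    exact Subtype.ext (hinj w w.2 (congrArg Subtype.val hw))
  have hrange : LinearMap.range (TV : V Ω →ₗ[ℝ] V Ω) = ⊤ := by
    rw [LinearMap.range_eq_top]
    intro f
    obtain ⟨w, hw⟩ := hsurj f
    rw [hdiff] at hw
    have hPw : P w = 0 := by
      refine hdisj _ ?_ (hPR w)
      rw [eq_sub_of_add_eq' hw]
      exact (V Ω).sub_mem f.2 (hTV w)
    rw [hPw, add_zero] at hw
    exact ⟨⟨w, hPker w hPw⟩, Subtype.ext hw⟩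
  exact ⟨ContinuousLinearEquiv.ofBijective TV hker hrange, fun w => rfl⟩

/-- Elements of the `L²` closure of `𝒱` are orthogonal to rigid motions. -/
lemma integral_inner_eq_zero_of_mem_VL2 (hΩ : MeasurableSet Ω) (hb : Bornology.IsBounded Ω)
    {w : Lp (E d) 2 (volume.restrict Ω)} (hw : w ∈ VL2 Ω) {π : E d → E d}
    (hπ : π ∈ rigidMotions d) : ∫ x in Ω, inner ℝ (w x) (π x) = 0 := by
  have := isFiniteMeasure_restrict_of_isBounded hb
  have hπ2 : MemLp π 2 (volume.restrict Ω) :=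
    (memLp_top_of_continuous hΩ hb (continuous_of_mem_rigidMotions hπ)).mono_exponent le_top
  have hinner (v : Lp (E d) 2 (volume.restrict Ω)) :
      inner ℝ v (hπ2.toLp π) = ∫ x in Ω, inner ℝ (v x) (π x) := by
    rw [L2.inner_def]
    refine integral_congr_ae ?_
    filter_upwards [hπ2.coeFn_toLp] with x hx
    rw [hx]
  have hclosed : IsClosed {v : Lp (E d) 2 (volume.restrict Ω) | inner ℝ v (hπ2.toLp π) = 0} :=
    isClosed_eq (by fun_prop) continuous_const
  have hsub : VL2 Ω ⊆ {v : Lp (E d) 2 (volume.restrict Ω) | inner ℝ v (hπ2.toLp π) = 0} := by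
    refine closure_minimal ?_ hclosed
    rintro v ⟨u, hu, hvu⟩
    change inner ℝ v (hπ2.toLp π) = 0
    rw [hinner, ← (hu π hπ).2]
    refine integral_congr_ae ?_
    filter_upwards [hvu] with x hx
    rw [hx]
  rw [← hinner]
  exact hsub hw

/-- The linearized force is orthogonal to rigid motions. -/
lemma integral_inner_forceDeriv_eq_zero (hd : 2 ≤ d) (hΩ : MeasurableSet Ω) (hb : Bornology.IsBounded Ω)
    (hε : 0 < ε) (hJ : IsInfluenceFunction J) {g : ℝ → ℝ} {re rc : ℝ}
    (hg : IsCohesivePotential g re rc) {u : E d → E d}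
    (hu : AEStronglyMeasurable u (volume.restrict Ω)) {w : E d → E d}
    (hw : AEStronglyMeasurable w (volume.restrict Ω)) {m : ℝ}
    (hm : ∀ᵐ x ∂volume.restrict Ω, ‖w x‖ ≤ m) {π : E d → E d} (hπ : π ∈ rigidMotions d) :
    ∫ x in Ω, inner ℝ (forceDeriv Ω ε J g u w x) (π x) = 0 := by
  have := isFiniteMeasure_restrict_of_isBounded hb
  set μ := volume.restrict Ω with hμ
  obtain ⟨C, hC⟩ := hg.bounded 2 (by norm_num)
  have hh : Measurable (iteratedDeriv 2 g) :=
    (hg.differentiable 2 (by norm_num)).continuous.measurable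
  set κ : E d → E d → ℝ := fun x y => 2 * bondWeight ε J (iteratedDeriv 2 g) u x y *
    inner ℝ (dir (y - x)) (w y - w x) with hκ
  have hsymm : ∀ x y, κ y x = κ x y := by
    intro x y
    have h1 : dir (x - y) = -dir (y - x) := by rw [← dir_neg, neg_sub]
    have h2 : w x - w y = -(w y - w x) := (neg_sub _ _).symm
    simp only [hκ, bondWeight_symm _ u x y, h1, h2, inner_neg_neg]
  have hdir : Measurable fun q : E d × E d => dir (q.2 - q.1) := measurable_dir.comp (by fun_prop)
  have hw1 : AEMeasurable (fun q : E d × E d => w q.1) (μ.prod μ) := hw.comp_fst.aemeasurable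
  have hw2 : AEMeasurable (fun q : E d × E d => w q.2) (μ.prod μ) := hw.comp_snd.aemeasurable
  have hcm : AEMeasurable (fun q : E d × E d => bondWeight ε J (iteratedDeriv 2 g) u q.1 q.2)
      (μ.prod μ) := aemeasurable_bond_weight hJ hh hu
  have hκm : AEMeasurable (fun q : E d × E d => κ q.1 q.2) (μ.prod μ) :=
    (hcm.const_mul 2).mul (hdir.aemeasurable.inner (hw2.sub hw1))
  have hle : ∀ᵐ q ∂(μ.prod μ), |κ q.1 q.2| ≤ 4 * C * m * kern ε J (q.2 - q.1) := by
    filter_upwards [Measure.quasiMeasurePreserving_fst.ae hm,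
      Measure.quasiMeasurePreserving_snd.ae hm] with q h1 h2
    have h3 := abs_bondWeight_le hε hJ hC u q.1 q.2
    have h4 : |inner ℝ (dir (q.2 - q.1)) (w q.2 - w q.1)| ≤ 1 * (m + m) :=
      (abs_real_inner_le_norm _ _).trans
        (mul_le_mul (norm_dir_le _) ((norm_sub_le _ _).trans (add_le_add h2 h1)) (norm_nonneg _)
          zero_le_one)
    have h5 : 0 ≤ C * kern ε J (q.2 - q.1) := (abs_nonneg _).trans h3
    simp only [hκ, abs_mul, abs_two]
    calc _ ≤ 2 * (C * kern ε J (q.2 - q.1)) * (1 * (m + m)) := by gcongr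
      _ = _ := by ring
  have key := integral_inner_rigidMotion_eq_zero hΩ hb hsymm hκm
    (k := fun z => 4 * C * m * kern ε J z) ((integrable_kern hd hε hJ).const_mul _) hle hπ
  rw [← neg_eq_zero, ← integral_neg] at key
  rw [← key]
  refine integral_congr_ae (Filter.Eventually.of_forall fun x => ?_)
  simp only [forceDeriv_eq_neg_integral_smul_dir, inner_neg_left, hκ]

end OrthogonalComplement

/-! ### The nonlinear force: values in `𝒱` and Fréchet differentiability. -/

section Force

variable {d : ℕ} {ε : ℝ} {J g : ℝ → ℝ} {re rc : ℝ} {Ω : Set (E d)}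

lemma IsCohesivePotential.hasDerivAt_deriv (hg : IsCohesivePotential g re rc) (r : ℝ) :
    HasDerivAt (deriv g) (iteratedDeriv 2 g r) r := by
  have h := (hg.differentiable 1 (by norm_num) r).hasDerivAt
  rwa [← iteratedDeriv_succ, iteratedDeriv_one] at h

/-- Second order Taylor estimate for `g'`. -/
lemma IsCohesivePotential.exists_taylor_bound (hg : IsCohesivePotential g re rc) :
    ∃ C : ℝ, 0 ≤ C ∧ ∀ s t : ℝ,
      |deriv g (s + t) - deriv g s - iteratedDeriv 2 g s * t| ≤ C * t ^ 2 := by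
  obtain ⟨C, hC⟩ := hg.bounded 3 le_rfl
  refine ⟨C, (abs_nonneg _).trans (hC 0), fun s t => ?_⟩
  -- The bound on `g'''` makes `g''` Lipschitz; applying the mean value inequality to `g' - g''(s)
  -- ·` on the ball of radius `|t|` then gives `C t²`.
  have hlip : ∀ r, |iteratedDeriv 2 g r - iteratedDeriv 2 g s| ≤ C * |r - s| := by
    intro r
    refine Convex.norm_image_sub_le_of_norm_hasDerivWithin_le (s := Set.univ)
      (f' := iteratedDeriv 3 g) (fun x _ => ?_) (fun x _ => hC x) convex_univ trivial trivial
    have h := (hg.differentiable 2 (by norm_num) x).hasDerivAt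
    rw [← iteratedDeriv_succ] at h
    exact h.hasDerivWithinAt
  have hmem : s + t ∈ Metric.closedBall s |t| := by simp
  have h := Convex.norm_image_sub_le_of_norm_hasDerivWithin_le (𝕜 := ℝ)
    (s := Metric.closedBall s |t|)
    (f := fun r => deriv g r - iteratedDeriv 2 g s * r)
    (f' := fun r => iteratedDeriv 2 g r - iteratedDeriv 2 g s) (C := C * |t|)
    (fun x _ => ?_) (fun x hx => ?_) (convex_closedBall s |t|)
    (Metric.mem_closedBall_self (abs_nonneg t)) hmem
  · rw [add_sub_cancel_left, Real.norm_eq_abs, Real.norm_eq_abs, mul_assoc, ← sq, sq_abs] at h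
    convert h using 2
    ring
  · have h1 := (hg.hasDerivAt_deriv x).sub ((hasDerivAt_id x).const_mul (iteratedDeriv 2 g s))
    rw [mul_one] at h1
    exact h1.hasDerivWithinAt
  · refine (hlip x).trans ?_
    have hC0 : 0 ≤ C := (abs_nonneg _).trans (hC 0)
    rw [Metric.mem_closedBall, Real.dist_eq] at hx
    gcongr

/-- The scalar bond force. -/
def bondForce (ε : ℝ) (J g : ℝ → ℝ) (u : E d → E d) (x y : E d) : ℝ :=
  2 * (kern ε J (y - x) * Real.sqrt ‖y - x‖ * deriv g (stretch (y - x) (u y - u x)))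

lemma force_eq_neg_integral_bondForce (u : E d → E d) (x : E d) :
    force Ω ε J g u x = -∫ y in Ω, bondForce ε J g u x y • dir (y - x) :=
  force_eq Ω g u x

lemma bondForce_symm (u : E d → E d) (x y : E d) :
    bondForce ε J g u y x = bondForce ε J g u x y := by
  rw [bondForce, bondForce, ← neg_sub y x, ← neg_sub (u y) (u x), kern_neg, stretch_neg_neg,
    norm_neg]

lemma kern_mul_sqrt_le (hε : 0 < ε) (hJ : IsInfluenceFunction J) (z : E d) :
    kern ε J z * Real.sqrt ‖z‖ ≤ Real.sqrt ε * kern ε J z := by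
  by_cases hz : z ∈ Metric.ball (0 : E d) ε
  · rw [mul_comm]
    have := kern_nonneg hε hJ z
    gcongr
    exact (mem_ball_zero_iff.1 hz).le
  · simp [kern_eq_zero hz]

lemma abs_bondForce_le (hε : 0 < ε) (hJ : IsInfluenceFunction J) {C : ℝ}
    (hC : ∀ r, |deriv g r| ≤ C) (u : E d → E d) (x y : E d) :
    |bondForce ε J g u x y| ≤ 2 * Real.sqrt ε * C * kern ε J (y - x) := by
  have hk := kern_nonneg hε hJ (y - x)
  rw [bondForce, abs_mul, abs_mul, abs_two, abs_of_nonneg (mul_nonneg hk (Real.sqrt_nonneg _))]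
  calc _ ≤ 2 * (Real.sqrt ε * kern ε J (y - x) * C) := by
        refine mul_le_mul_of_nonneg_left ?_ zero_le_two
        exact mul_le_mul (kern_mul_sqrt_le hε hJ _) (hC _) (abs_nonneg _) (by positivity)
    _ = _ := by ring

lemma aemeasurable_bondForce {α : Type*} [MeasurableSpace α] {ν : Measure α}
    (hJ : IsInfluenceFunction J) {z p : α → E d}
    (hz : AEMeasurable z ν) (hp : AEMeasurable p ν) :
    AEMeasurable (fun a => 2 * (kern ε J (z a) * Real.sqrt ‖z a‖ * deriv g (stretch (z a) (p a))))
      ν := by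
  have h1 : AEMeasurable (fun a => kern ε J (z a)) ν := (measurable_kern hJ).comp_aemeasurable hz
  have h2 := (measurable_deriv g).comp_aemeasurable (aemeasurable_stretch hz hp)
  exact ((h1.mul hz.norm.sqrt).mul h2).const_mul 2

lemma integrable_bondForce_smul_dir (hd : 2 ≤ d) (hε : 0 < ε) (hJ : IsInfluenceFunction J)
    {C : ℝ} (hC : ∀ r, |deriv g r| ≤ C) {u : E d → E d}
    (hu : AEStronglyMeasurable u (volume.restrict Ω)) (x : E d) :
    Integrable (fun y => bondForce ε J g u x y • dir (y - x)) (volume.restrict Ω) := by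
  have hm : AEMeasurable (bondForce ε J g u x) (volume.restrict Ω) :=
    aemeasurable_bondForce hJ (measurable_id.sub_const x).aemeasurable
      (hu.aemeasurable.sub_const (u x))
  have hdir : Measurable fun y : E d => dir (y - x) :=
    measurable_dir.comp (measurable_id.sub_const x)
  refine ((integrable_kern_sub hd hε hJ x Ω).const_mul (2 * Real.sqrt ε * C)).mono'
    (hm.smul hdir.aemeasurable).aestronglyMeasurable (Filter.Eventually.of_forall fun y => ?_)
  rw [norm_smul, Real.norm_eq_abs]
  exact (mul_le_of_le_one_right (abs_nonneg _) (norm_dir_le _)).trans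
    (abs_bondForce_le hε hJ hC u x y)

lemma norm_force_le (hd : 2 ≤ d) (hε : 0 < ε) (hJ : IsInfluenceFunction J)
    {C : ℝ} (hC : ∀ r, |deriv g r| ≤ C) (u : E d → E d) (x : E d) :
    ‖force Ω ε J g u x‖ ≤ 2 * Real.sqrt ε * C * ∫ z : E d, kern ε J z := by
  have hC0 : 0 ≤ C := (abs_nonneg _).trans (hC 0)
  rw [force_eq_neg_integral_bondForce, norm_neg]
  calc _ ≤ ∫ y in Ω, 2 * Real.sqrt ε * C * kern ε J (y - x) := by
        refine norm_integral_le_of_norm_le ((integrable_kern_sub hd hε hJ x Ω).const_mul _)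
          (Filter.Eventually.of_forall fun y => ?_)
        rw [norm_smul, Real.norm_eq_abs]
        exact (mul_le_of_le_one_right (abs_nonneg _) (norm_dir_le _)).trans
          (abs_bondForce_le hε hJ hC u x y)
    _ ≤ ∫ y, 2 * Real.sqrt ε * C * kern ε J (y - x) :=
        setIntegral_le_integral (((integrable_kern hd hε hJ).comp_sub_right x).const_mul _)
          (Filter.Eventually.of_forall fun y =>
            mul_nonneg (by positivity) (kern_nonneg hε hJ _))
    _ = _ := by rw [integral_const_mul, integral_sub_right_eq_self]

/-- The force of an `L^∞` displacement is an element of `𝒱`. -/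
lemma exists_mem_V_ae_eq_force (hd : 2 ≤ d) (hΩ : MeasurableSet Ω) (hb : Bornology.IsBounded Ω)
    (hε : 0 < ε) (hJ : IsInfluenceFunction J) (hg : IsCohesivePotential g re rc) {u : E d → E d}
    (hu : AEStronglyMeasurable u (volume.restrict Ω)) :
    ∃ f : V Ω, f.1 =ᵐ[volume.restrict Ω] force Ω ε J g u := by
  have := isFiniteMeasure_restrict_of_isBounded hb
  obtain ⟨C, hC⟩ := hg.bounded 1 (by norm_num)
  rw [iteratedDeriv_one] at hC
  have hκm : AEMeasurable (fun q : E d × E d => bondForce ε J g u q.1 q.2)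
      ((volume.restrict Ω).prod (volume.restrict Ω)) :=
    aemeasurable_bondForce hJ (measurable_snd.sub measurable_fst).aemeasurable
      (hu.comp_snd.aemeasurable.sub hu.comp_fst.aemeasurable)
  have hdir : Measurable fun q : E d × E d => dir (q.2 - q.1) := measurable_dir.comp (by fun_prop)
  have hmeas : AEStronglyMeasurable (force Ω ε J g u) (volume.restrict Ω) := by
    rw [funext fun x => force_eq_neg_integral_bondForce (Ω := Ω) (ε := ε) (J := J) (g := g) u x]
    exact (hκm.smul hdir.aemeasurable).aestronglyMeasurable.integral_prod_right'.neg
  have hmem : MemLp (force Ω ε J g u) ∞ (volume.restrict Ω) :=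
    memLp_top_of_ae_le hmeas
      (Filter.Eventually.of_forall fun x => norm_force_le hd hε hJ hC u x)
  refine ⟨⟨hmem.toLp _, ?_⟩, hmem.coeFn_toLp⟩
  rw [mem_V_iff_integral hΩ hb]
  intro π hπ
  have key := integral_inner_rigidMotion_eq_zero hΩ hb (fun x y => bondForce_symm u x y) hκm
    (k := fun z => 2 * Real.sqrt ε * C * kern ε J z) ((integrable_kern hd hε hJ).const_mul _)
    (Filter.Eventually.of_forall fun q => abs_bondForce_le hε hJ hC u q.1 q.2) hπ
  rw [← neg_eq_zero, ← integral_neg] at key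
  rw [← key]
  refine integral_congr_ae ?_
  filter_upwards [hmem.coeFn_toLp] with x hx
  rw [hx, force_eq_neg_integral_bondForce, inner_neg_left]

/-- Quadratic estimate for the linearization error of the force at a point. -/
lemma exists_norm_force_sub_le (hd : 2 ≤ d) (hε : 0 < ε) (hJ : IsInfluenceFunction J)
    (hg : IsCohesivePotential g re rc) (Ω : Set (E d)) :
    ∃ C : ℝ, 0 ≤ C ∧ ∀ (u v w : E d → E d) (m : ℝ), 0 ≤ m →
      AEStronglyMeasurable u (volume.restrict Ω) → AEStronglyMeasurable v (volume.restrict Ω) →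
      AEStronglyMeasurable w (volume.restrict Ω) →
      (∀ᵐ y ∂volume.restrict Ω, v y = u y + w y ∧ ‖w y‖ ≤ m) →
      ∀ x, v x = u x + w x → ‖w x‖ ≤ m →
        ‖force Ω ε J g v x - force Ω ε J g u x - forceDeriv Ω ε J g u w x‖ ≤ C * m ^ 2 := by
  obtain ⟨C₃, hC₃0, hC₃⟩ := hg.exists_taylor_bound
  obtain ⟨C₁, hC₁⟩ := hg.bounded 1 (by norm_num)
  rw [iteratedDeriv_one] at hC₁
  obtain ⟨C₂, hC₂⟩ := hg.bounded 2 (by norm_num)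
  have hh : Measurable (iteratedDeriv 2 g) :=
    (hg.differentiable 2 (by norm_num)).continuous.measurable
  -- The remainder has weight `kern * √‖z‖ * t²` with `|t| ≤ 2 m / √‖z‖`, which leaves `kern /
  -- √‖z‖`; the constant `8` is `2 * 2²`.
  set k : E d → ℝ := fun z => kern ε J z * (Real.sqrt ‖z‖)⁻¹ with hk
  have hki : Integrable k := integrable_kern_mul_inv_sqrt hd hε hJ
  have hk0 z : 0 ≤ k z := mul_nonneg (kern_nonneg hε hJ z) (by positivity)
  refine ⟨8 * C₃ * ∫ z, k z, mul_nonneg (by positivity) (integral_nonneg hk0), ?_⟩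
  intro u v w m hm hu hv hw hae x hvx hwx
  have hiD : Integrable (fun y => (2 * bondWeight ε J (iteratedDeriv 2 g) u x y *
      inner ℝ (dir (y - x)) (w y - w x)) • dir (y - x)) (volume.restrict Ω) := by
    have hdir : Measurable fun y : E d => dir (y - x) :=
      measurable_dir.comp (measurable_id.sub_const x)
    have hcm : AEMeasurable (bondWeight ε J (iteratedDeriv 2 g) u x) (volume.restrict Ω) :=
      (aestronglyMeasurable_kern_mul_stretch hJ hh hu x (u x)).aemeasurable
    refine ((integrable_kern_sub hd hε hJ x Ω).const_mul (4 * C₂ * m)).mono'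
      (((hcm.const_mul 2).mul (hdir.aemeasurable.inner (hw.aemeasurable.sub_const (w x)))).smul
        hdir.aemeasurable).aestronglyMeasurable ?_
    filter_upwards [hae] with y hy
    have h3 := abs_bondWeight_le hε hJ hC₂ u x y
    have h4 : |inner ℝ (dir (y - x)) (w y - w x)| ≤ 1 * (m + m) :=
      (abs_real_inner_le_norm _ _).trans
        (mul_le_mul (norm_dir_le _) ((norm_sub_le _ _).trans (add_le_add hy.2 hwx)) (norm_nonneg _)
          zero_le_one)
    have h5 : 0 ≤ C₂ * kern ε J (y - x) := (abs_nonneg _).trans h3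
    rw [norm_smul, Real.norm_eq_abs]
    refine (mul_le_of_le_one_right (abs_nonneg _) (norm_dir_le _)).trans ?_
    rw [abs_mul, abs_mul, abs_two]
    calc _ ≤ 2 * (C₂ * kern ε J (y - x)) * (1 * (m + m)) := by gcongr
      _ = _ := by ring
  have hiu := integrable_bondForce_smul_dir hd hε hJ hC₁ hu x
  have hiv := integrable_bondForce_smul_dir hd hε hJ hC₁ hv x
  have hpt : ∀ᵐ y ∂volume.restrict Ω,
      ‖bondForce ε J g v x y • dir (y - x) - bondForce ε J g u x y • dir (y - x) -
        (2 * bondWeight ε J (iteratedDeriv 2 g) u x y * inner ℝ (dir (y - x)) (w y - w x)) •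
          dir (y - x)‖ ≤ 8 * C₃ * m ^ 2 * k (y - x) := by
    filter_upwards [hae] with y hy
    rw [← sub_smul, ← sub_smul, norm_smul]
    refine (mul_le_of_le_one_right (norm_nonneg _) (norm_dir_le _)).trans ?_
    by_cases hyx : y = x
    · have : kern ε J (0 : E d) = 0 := by simp [kern]
      simp [bondForce, bondWeight, hyx, this, hk]
    have hz : 0 < ‖y - x‖ := norm_pos_iff.2 (sub_ne_zero.2 hyx)
    have hsq : 0 < Real.sqrt ‖y - x‖ := Real.sqrt_pos.2 hz
    set s := stretch (y - x) (u y - u x) with hs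
    set t := stretch (y - x) (w y - w x) with ht
    have hst : stretch (y - x) (v y - v x) = s + t := by
      rw [hs, ht, ← stretch_add, hy.1, hvx]
      congr 1
      abel
    have hin : inner ℝ (dir (y - x)) (w y - w x) = Real.sqrt ‖y - x‖ * t := by
      rw [ht, stretch, real_inner_comm, mul_inv_cancel_left₀ hsq.ne']
    have e1 : bondForce ε J g v x y - bondForce ε J g u x y -
        2 * bondWeight ε J (iteratedDeriv 2 g) u x y * inner ℝ (dir (y - x)) (w y - w x) =
        2 * (kern ε J (y - x) * Real.sqrt ‖y - x‖ *
          (deriv g (s + t) - deriv g s - iteratedDeriv 2 g s * t)) := by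
      rw [bondForce, bondForce, bondWeight, hst, hin]
      ring
    have hkn := kern_nonneg hε hJ (y - x)
    have htle : |t| ≤ (Real.sqrt ‖y - x‖)⁻¹ * (2 * m) := by
      refine (abs_stretch_le _ _).trans ?_
      gcongr
      exact (norm_sub_le _ _).trans (by linarith [hy.2])
    have ht2 : t ^ 2 ≤ ((Real.sqrt ‖y - x‖)⁻¹ * (2 * m)) ^ 2 := by
      rw [← sq_abs]
      gcongr
    rw [e1, Real.norm_eq_abs, abs_mul, abs_two, abs_mul,
      abs_of_nonneg (mul_nonneg hkn hsq.le)]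
    calc _ ≤ 2 * (kern ε J (y - x) * Real.sqrt ‖y - x‖ *
          (C₃ * ((Real.sqrt ‖y - x‖)⁻¹ * (2 * m)) ^ 2)) := by
          gcongr
          exact (hC₃ s t).trans (by gcongr)
      _ = _ := by
          simp only [hk]
          field_simp
          ring
  have hdecomp : force Ω ε J g v x - force Ω ε J g u x - forceDeriv Ω ε J g u w x =
      -∫ y in Ω, (bondForce ε J g v x y • dir (y - x) - bondForce ε J g u x y • dir (y - x) -
        (2 * bondWeight ε J (iteratedDeriv 2 g) u x y * inner ℝ (dir (y - x)) (w y - w x)) •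
          dir (y - x)) := by
    have h1 : ∫ y in Ω, (bondForce ε J g v x y • dir (y - x) - bondForce ε J g u x y • dir (y - x) -
        (2 * bondWeight ε J (iteratedDeriv 2 g) u x y * inner ℝ (dir (y - x)) (w y - w x)) •
          dir (y - x)) = _ := integral_sub (hiv.sub hiu) hiD
    rw [h1, integral_sub hiv hiu, force_eq_neg_integral_bondForce,
      force_eq_neg_integral_bondForce, forceDeriv_eq_neg_integral_smul_dir]
    abel
  rw [hdecomp, norm_neg]
  calc _ ≤ ∫ y in Ω, 8 * C₃ * m ^ 2 * k (y - x) :=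
        norm_integral_le_of_norm_le ((hki.comp_sub_right x).restrict.const_mul _) hpt
    _ ≤ ∫ y, 8 * C₃ * m ^ 2 * k (y - x) :=
        setIntegral_le_integral ((hki.comp_sub_right x).const_mul _)
          (Filter.Eventually.of_forall fun y => mul_nonneg (by positivity) (hk0 _))
    _ = 8 * C₃ * (∫ z, k z) * m ^ 2 := by
        rw [integral_const_mul, integral_sub_right_eq_self]
        ring

/-- The force on `𝒱` is Fréchet differentiable in the `L^∞` norm. -/
lemma hasFDerivAt_force (hd : 2 ≤ d) (hε : 0 < ε) (hJ : IsInfluenceFunction J)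
    (hg : IsCohesivePotential g re rc) {u₀ : E d → E d} (hu₀ : MemLp u₀ ∞ (volume.restrict Ω))
    (hu₀V : hu₀.toLp u₀ ∈ V Ω) {T : V Ω →L[ℝ] V Ω}
    (hT : ∀ w : V Ω, (T w).1 =ᵐ[volume.restrict Ω] forceDeriv Ω ε J g u₀ w.1) {L : V Ω → V Ω}
    (hL : ∀ u : V Ω, (L u).1 =ᵐ[volume.restrict Ω] force Ω ε J g u.1) :
    HasFDerivAt L T ⟨hu₀.toLp u₀, hu₀V⟩ := by
  obtain ⟨C, hC0, hC⟩ := exists_norm_force_sub_le hd hε hJ hg Ω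
  set U₀ : V Ω := ⟨hu₀.toLp u₀, hu₀V⟩ with hU₀
  have hquad : ∀ u : V Ω, ‖L u - L U₀ - T (u - U₀)‖ ≤ C * ‖u - U₀‖ ^ 2 := by
    intro u
    refine norm_Linfty_le_of_ae_le (by positivity) ?_
    have hae : ∀ᵐ y ∂volume.restrict Ω,
        u.1 y = u₀ y + (u - U₀).1 y ∧ ‖(u - U₀).1 y‖ ≤ ‖u - U₀‖ := by
      filter_upwards [Lp.coeFn_sub u.1 U₀.1, hu₀.coeFn_toLp, ae_norm_le_norm_Linfty (u - U₀).1]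
        with y h1 h2 h3
      refine ⟨?_, h3⟩
      change u.1 y = u₀ y + (u.1 - U₀.1) y
      rw [h1, Pi.sub_apply]
      change u.1 y = u₀ y + (u.1 y - hu₀.toLp u₀ y)
      rw [h2]
      abel
    -- The force depends on the integrand a.e. and on the value at `x`, so replacing the `L^∞`
    -- representative by the given `u₀` is harmless for almost every `x`.
    have hU₀force : (L U₀).1 =ᵐ[volume.restrict Ω] force Ω ε J g u₀ := by
      filter_upwards [hL U₀, hu₀.coeFn_toLp] with x h1 h2
      rw [h1, force_eq, force_eq]
      congr 1
      refine integral_congr_ae ?_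
      filter_upwards [hu₀.coeFn_toLp] with y h3
      change (2 * (_ * deriv g (stretch (y - x) (hu₀.toLp u₀ y - hu₀.toLp u₀ x)))) • _ = _
      rw [h2, h3]
    filter_upwards [Lp.coeFn_sub (L u - L U₀).1 (T (u - U₀)).1, Lp.coeFn_sub (L u).1 (L U₀).1,
      hL u, hU₀force, hT (u - U₀), hae] with x h1 h2 h3 h4 h5 h6
    change ‖((L u - L U₀).1 - (T (u - U₀)).1 : Lp (E d) ∞ (volume.restrict Ω)) x‖ ≤ _
    rw [h1, Pi.sub_apply, h5]
    change ‖((L u).1 - (L U₀).1 : Lp (E d) ∞ (volume.restrict Ω)) x - _‖ ≤ _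
    rw [h2, Pi.sub_apply, h3, h4]
    exact hC u₀ u.1 (u - U₀).1 ‖u - U₀‖ (norm_nonneg _) hu₀.1 (Lp.aestronglyMeasurable _)
      (Lp.aestronglyMeasurable _) hae x h6.1 h6.2
  rw [hasFDerivAt_iff_isLittleO]
  refine Asymptotics.IsBigO.trans_isLittleO (g := fun u : V Ω => ‖u - U₀‖ ^ 2) ?_
    (Asymptotics.isLittleO_pow_sub_sub U₀ one_lt_two)
  refine Asymptotics.IsBigO.of_bound C (Filter.Eventually.of_forall fun u => ?_)
  rw [norm_pow, norm_norm]
  exact hquad u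

end Force

end Peridynamics

end

/-! ### Assembly. -/

theorem theorem3p5 {d : ℕ} (hd : d = 2 ∨ d = 3)
    {Ω : Set (Peridynamics.E d)} (hΩ_open : IsOpen Ω) (hΩ_conn : IsConnected Ω)
    (hΩ_bdd : Bornology.IsBounded Ω) (hΩ_cone : Peridynamics.InteriorConeCondition Ω)
    {ε : ℝ} (hε : 0 < ε)
    {J g : ℝ → ℝ} {re rc : ℝ} (hJ : Peridynamics.IsInfluenceFunction J)
    (hg : Peridynamics.IsCohesivePotential g re rc)
    (u₀ : Peridynamics.E d → Peridynamics.E d) (hu₀ : MemLp u₀ ∞ (volume.restrict Ω))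
    (hu₀V : hu₀.toLp u₀ ∈ Peridynamics.V Ω)
    (hu₀S : Peridynamics.StrictlyInsideStrengthDomain Ω ε re rc u₀) :
    -- uniform positive definiteness of the stability tensor
    (∃ γ : ℝ, 0 < γ ∧ ∀ x ∈ Ω, ∀ v : Peridynamics.E d, v ≠ 0 →
      γ * ‖v‖ ^ 2 < inner ℝ (Peridynamics.stabilityTensor Ω ε J g u₀ x v) v) ∧
    -- trivial kernel, already on the closure of `𝒱` in `L²`
    (∀ w ∈ Peridynamics.VL2 Ω,
      Peridynamics.forceDeriv Ω ε J g u₀ w =ᵐ[volume.restrict Ω] 0 → w = 0) ∧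
    -- `D(𝓛)[u₀]` is a bounded operator on `𝒱` with a bounded inverse, and it is the Fréchet
    -- derivative at `u₀` of the force `𝓛 : 𝒱 → 𝒱`
    (∃ T : Peridynamics.V Ω ≃L[ℝ] Peridynamics.V Ω,
      (∀ w : Peridynamics.V Ω,
        ⇑(T w).1 =ᵐ[volume.restrict Ω] Peridynamics.forceDeriv Ω ε J g u₀ ⇑w.1) ∧
      ∃ L : Peridynamics.V Ω → Peridynamics.V Ω,
        (∀ u : Peridynamics.V Ω,
          ⇑(L u).1 =ᵐ[volume.restrict Ω] Peridynamics.force Ω ε J g ⇑u.1) ∧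
        HasFDerivAt L (T : Peridynamics.V Ω →L[ℝ] Peridynamics.V Ω)
          ⟨hu₀.toLp u₀, hu₀V⟩) := by
  open Peridynamics in
  have hd2 : 2 ≤ d := by omega
  have hΩm := hΩ_open.measurableSet
  have hfin := isFiniteMeasure_restrict_of_isBounded hΩ_bdd
  -- Stated for functions rather than classes, so that it serves both the `L²` closure and the
  -- injectivity on `𝒱` in `L^∞`.
  have hker : ∀ w : E d → E d, MemLp w 2 (volume.restrict Ω) →
      (∀ π ∈ rigidMotions d, ∫ x in Ω, inner ℝ (w x) (π x) = 0) →
      forceDeriv Ω ε J g u₀ w =ᵐ[volume.restrict Ω] 0 → w =ᵐ[volume.restrict Ω] 0 :=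
    fun w hw horth h0 =>
      ae_eq_zero_of_forceDeriv_ae_eq_zero hd2 hΩ_open hΩ_conn hε hJ hg hu₀.1 hu₀S hw horth h0
  refine ⟨exists_pos_lt_inner_stabilityTensor hd2 hΩ_open hΩ_cone hε hJ hg hu₀.1 hu₀S,
    fun w hw h0 => ?_, ?_⟩
  · exact (Lp.eq_zero_iff_ae_eq_zero).2 (hker w (Lp.memLp w)
      (fun π hπ => integral_inner_eq_zero_of_mem_VL2 hΩm hΩ_bdd hw hπ) h0)
  obtain ⟨T, B, F, hT, hTBF, hB, hF⟩ :=
    exists_linearizedForce hd2 hΩ_open hΩ_bdd hΩ_cone hε hJ hg hu₀ hu₀S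
  have hTV : ∀ w, T w ∈ V Ω := fun w => by
    rw [mem_V_iff_integral hΩm hΩ_bdd]
    intro π hπ
    rw [← integral_inner_forceDeriv_eq_zero hd2 hΩm hΩ_bdd hε hJ hg hu₀.1
      (Lp.aestronglyMeasurable w) (ae_norm_le_norm_Linfty w) hπ]
    refine integral_congr_ae ?_
    filter_upwards [hT w] with x hx
    rw [hx]
  have hinj : ∀ w ∈ V Ω, T w = 0 → w = 0 := by
    intro w hw h0
    refine (Lp.eq_zero_iff_ae_eq_zero).2 (hker w ((Lp.memLp w).mono_exponent le_top)
      ((mem_V_iff_integral hΩm hΩ_bdd).1 hw) ?_)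
    refine (hT w).symm.trans ?_
    rw [h0]
    exact Lp.coeFn_zero _ _ _
  obtain ⟨T', hT'⟩ := exists_equiv_V hΩm hΩ_bdd hTBF hB hF hTV hinj
  refine ⟨T', fun w => (hT' w).symm ▸ hT w, ?_⟩
  choose L hL using fun u : V Ω =>
    exists_mem_V_ae_eq_force hd2 hΩm hΩ_bdd hε hJ hg (Lp.aestronglyMeasurable u.1)
  refine ⟨L, hL, ?_⟩
  exact hasFDerivAt_force hd2 hε hJ hg hu₀ hu₀V (fun w => (hT' w).symm ▸ hT w) hL
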